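/- All systems are causal, discrete-time, finite-dimensional, real linear time-invariant (LTI) systems given by state-space models $x_{t+1}=Ax_t+Bu_t$, $y_t=Cx_t+Du_t$ with real matrices. Such a system $G$ is called stable if the spectral radius of $A$ is less than $1$. Its transfer function is $G(z)=C(zI-A)^{-1}B+D$ and, for stable $G$, $\|G\|_\infty:=\max_{\theta\in[0,2\pi]}\bar\sigma(G(e^{j\theta}))$, where $\bar\sigma$ denotes the largest singular value. Let $M$ be a stable $(n_v+n_e)\times(n_w+n_d)$ LTI system, $$\begin{bmatrix}x_{t+1}\\ v_t\\ e_t\end{bmatrix}=\begin{bmatrix}A&B_w&B_d\\ C_v&D_{vw}&D_{vd}\\ C_e&D_{ew}&D_{ed}\end{bmatrix}\begin{bmatrix}x_t\\ w_t\\ d_t\end{bmatrix}.$$ For an $n_w\times n_v$ LTI system $\Delta$ (of arbitrary finite state dimension), $x^\Delta_{t+1}=A_\Delta x^\Delta_t+B_\Delta v_t$, $w_t=C_\Delta x^\Delta_t+D_\Delta v_t$, the interconnection $F_U(M,\Delta)$ is called well-posed if $\begin{bmatrix}I_{n_v}&-D_{vw}\\-D_\Delta&I_{n_w}\end{bmatrix}$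 is nonsingular. In that case $(v_t,w_t)$ can be eliminated, and $F_U(M,\Delta)$ denotes the resulting LTI system with state $(x,x^\Delta)$, input $d$ and output $e$. The following are equivalent: (A) There exists a function $D:[0,2\pi]\to(0,\infty)$ such that, for all $\theta\in[0,2\pi]$, $$\bar\sigma\left(\begin{bmatrix}D(\theta)I_{n_v}&0\\0&I_{n_e}\end{bmatrix}M(e^{j\theta})\begin{bmatrix}D(\theta)^{-1}I_{n_w}&0\\0&I_{n_d}\end{bmatrix}\right)<1 .$$ (B) For every stable $n_w\times n_v$ LTI system $\Delta$ with $\|\Delta\|_\infty\le 1$, the interconnection $F_U(M,\Delta)$ is well-posed and stable, and $\|F_U(M,\Delta)\|_\infty<1$. -/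

import Mathlib

/-- A causal, discrete-time, finite-dimensional, real LTI system
`x(t+1) = A x(t) + B u(t)`, `y(t) = C x(t) + D u(t)`,
with state, input and output coordinates indexed by `X`, `U` and `Y`. -/
structure LTISystem (X U Y : Type*) where
  A : Matrix X X ℝ
  B : Matrix X U ℝ
  C : Matrix Y X ℝ
  D : Matrix Y U ℝ

/-- The maximum singular value of a complex matrix, as its induced Euclidean norm. -/
noncomputable def sigmaMax {m n : Type*} [Fintype m] [Fintype n] [DecidableEq n]
    (A : Matrix m n ℂ) : ℝ :=
  ‖LinearMap.toContinuousLinearMap (Matrix.toEuclideanLin A)‖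

/-- The induced Euclidean norm is the largest (the zeroth) singular value. -/
theorem sigmaMax_eq_singularValues {m n : Type*} [Fintype m] [Fintype n] [DecidableEq n]
    (A : Matrix m n ℂ) :
    sigmaMax A = (Matrix.toEuclideanLin A).singularValues 0 := by
  set T := Matrix.toEuclideanLin A with hT
  set n' := Module.finrank ℂ (EuclideanSpace ℂ n) with hn'
  set S := T.isSymmetric_adjoint_comp_self
  set b := S.eigenvectorBasis hn'.symm
  have hsq : ∀ x, ‖T x‖ ^ 2 ≤ (T.singularValues 0) ^ 2 * ‖x‖ ^ 2 := by
    intro x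
    have h1 : (‖T x‖ ^ 2 : ℝ) = RCLike.re (inner ℂ ((LinearMap.adjoint T ∘ₗ T) x) x) := by
      rw [LinearMap.comp_apply, LinearMap.adjoint_inner_left, inner_self_eq_norm_sq (𝕜 := ℂ)]
    have h2 : inner ℂ ((LinearMap.adjoint T ∘ₗ T) x) x
        = ∑ i : Fin n', ((T.singularValues i ^ 2 * ‖inner ℂ (b i) x‖ ^ 2 : ℝ) : ℂ) := by
      rw [← b.sum_inner_mul_inner]
      refine Finset.sum_congr rfl fun i _ => ?_
      rw [S x (b i), S.apply_eigenvectorBasis, inner_smul_right, T.sq_singularValues_fin hn'.symm,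
        ← inner_conj_symm x (b i), mul_assoc, RCLike.conj_mul]
      push_cast
      rfl
    rw [h1, h2, ← b.sum_sq_norm_inner_right x, Finset.mul_sum, map_sum]
    refine Finset.sum_le_sum fun i _ => ?_
    rw [RCLike.re_eq_complex_re, Complex.ofReal_re]
    have := T.singularValues_antitone (Nat.zero_le (i : ℕ))
    have := T.singularValues_nonneg i
    gcongr
  apply le_antisymm
  · refine ContinuousLinearMap.opNorm_le_bound _ (T.singularValues_nonneg 0) fun x => ?_
    refine le_of_sq_le_sq ?_ (mul_nonneg (T.singularValues_nonneg 0) (norm_nonneg x))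
    rw [mul_pow]
    exact hsq x
  · rcases Nat.eq_zero_or_pos n' with h0 | h0
    · rw [T.singularValues_of_finrank_le (by omega)]
      exact norm_nonneg _
    · obtain ⟨v, hv⟩ := (T.hasEigenvalue_adjoint_comp_self_sq_singularValues h0).exists_hasEigenvector
      have hv0 : 0 < ‖v‖ := norm_pos_iff.2 hv.2
      have h1 : ‖T v‖ ^ 2 = (T.singularValues 0 * ‖v‖) ^ 2 := by
        rw [← inner_self_eq_norm_sq (𝕜 := ℂ), ← LinearMap.adjoint_inner_left, ← LinearMap.comp_apply,
          hv.apply_eq_smul, inner_smul_left, mul_pow, ← inner_self_eq_norm_sq (𝕜 := ℂ) v]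
        simp [← Complex.ofReal_pow]
      have h2 : ‖T v‖ = T.singularValues 0 * ‖v‖ :=
        (sq_eq_sq₀ (norm_nonneg _) (mul_nonneg (T.singularValues_nonneg 0) hv0.le)).1 h1
      have h3 := (LinearMap.toContinuousLinearMap T).le_opNorm v
      rw [LinearMap.coe_toContinuousLinearMap', h2] at h3
      exact le_of_mul_le_mul_right h3 hv0

namespace LTISystem

/-- The complex transfer matrix `G(z) = C (z I - A)⁻¹ B + D`. -/
noncomputable def transfer {X U Y : Type*} [Fintype X] [DecidableEq X]
    (G : LTISystem X U Y) (z : ℂ) : Matrix Y U ℂ :=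
  G.C.map Complex.ofReal * (z • (1 : Matrix X X ℂ) - G.A.map Complex.ofReal)⁻¹
    * G.B.map Complex.ofReal + G.D.map Complex.ofReal

/-- The frequency response `G(e^{jθ})`. -/
noncomputable def freqResp {X U Y : Type*} [Fintype X] [DecidableEq X]
    (G : LTISystem X U Y) (θ : ℝ) : Matrix Y U ℂ :=
  G.transfer (Complex.exp (θ * Complex.I))

/-- Stability: the state matrix is Schur stable, that is, the spectral radius (the largest
modulus of a complex eigenvalue) of `A` is less than one. -/
def Stable {X U Y : Type*} [Fintype X] [DecidableEq X] (G : LTISystem X U Y) : Prop :=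
  spectralRadius ℂ (G.A.map Complex.ofReal) < 1

/-- The `H∞` norm of a stable system: the largest value of `σ̄(G(e^{jθ}))` over `θ ∈ [0, 2π]`
(a maximum for stable `G`, see `isGreatest_hinfNorm`). -/
noncomputable def hinfNorm {X U Y : Type*} [Fintype X] [DecidableEq X]
    [Fintype U] [DecidableEq U] [Fintype Y] (G : LTISystem X U Y) : ℝ :=
  sSup ((fun θ : ℝ => sigmaMax (G.freqResp θ)) '' Set.Icc 0 (2 * Real.pi))

theorem isGreatest_hinfNorm {X U Y : Type*} [Fintype X] [DecidableEq X]
    [Fintype U] [DecidableEq U] [Fintype Y] (G : LTISystem X U Y) (hG : G.Stable) :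
    IsGreatest ((fun θ : ℝ => sigmaMax (G.freqResp θ)) '' Set.Icc 0 (2 * Real.pi))
      G.hinfNorm := by
  have hdet : ∀ θ : ℝ, IsUnit (Complex.exp (θ * Complex.I) • (1 : Matrix X X ℂ)
      - G.A.map Complex.ofReal).det := by
    intro θ
    rw [← Matrix.isUnit_iff_isUnit_det]
    by_contra hne
    have hmem : Complex.exp (θ * Complex.I) ∈ spectrum ℂ (G.A.map Complex.ofReal) := by
      rw [spectrum.mem_iff, Algebra.algebraMap_eq_smul_one]
      exact hne
    have hle : (‖Complex.exp (θ * Complex.I)‖₊ : ENNReal) ≤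
        spectralRadius ℂ (G.A.map Complex.ofReal) :=
      le_iSup₂ (f := fun k (_ : k ∈ spectrum ℂ (G.A.map Complex.ofReal)) => (‖k‖₊ : ENNReal)) _ hmem
    have h1 : ‖Complex.exp (θ * Complex.I)‖₊ = 1 := by
      ext; simp
    rw [h1] at hle
    exact absurd (lt_of_le_of_lt hle hG) (by simp)
  have hcont : Continuous fun θ : ℝ => G.freqResp θ := by
    have hE : Continuous fun θ : ℝ => Complex.exp (θ * Complex.I) • (1 : Matrix X X ℂ)
      - G.A.map Complex.ofReal := by fun_prop
    have hinv : Continuous fun θ : ℝ => (Complex.exp (θ * Complex.I) • (1 : Matrix X X ℂ)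
        - G.A.map Complex.ofReal)⁻¹ := by
      simp only [Matrix.inv_def, Ring.inverse_eq_inv']
      exact (hE.matrix_det.inv₀ fun θ => (hdet θ).ne_zero).smul hE.matrix_adjugate
    unfold freqResp transfer
    exact ((continuous_const.matrix_mul hinv).matrix_mul continuous_const).add continuous_const
  have hs : Continuous fun θ : ℝ => sigmaMax (G.freqResp θ) := by
    have hlin : Continuous fun N : Matrix Y U ℂ =>
        LinearMap.toContinuousLinearMap (Matrix.toEuclideanLin N) :=
      LinearMap.continuous_of_finiteDimensional
        ((LinearMap.toContinuousLinearMap.toLinearMap).comp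
          (Matrix.toEuclideanLin (𝕜 := ℂ) (m := Y) (n := U)).toLinearMap)
    exact (hlin.comp hcont).norm
  exact (isCompact_Icc.image hs).isGreatest_sSup
    ((Set.nonempty_Icc.2 (by positivity)).image _)

section Interconnection

variable {X XΔ W Dd V E : Type*}
  [Fintype X] [DecidableEq X] [Fintype XΔ] [DecidableEq XΔ]
  [Fintype W] [DecidableEq W] [Fintype V] [DecidableEq V]

/-- The matrix `[I, -D_vw; -D_Δ, I]` acting on `(v, w)` in the interconnection of `M`
(inputs `(w, d)`, outputs `(v, e)`) with `Δ` (input `v`, output `w`). -/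
def loopMatrix (M : LTISystem X (W ⊕ Dd) (V ⊕ E)) (Δ : LTISystem XΔ V W) :
    Matrix (V ⊕ W) (V ⊕ W) ℝ :=
  Matrix.fromBlocks 1 (-M.D.toBlocks₁₁) (-Δ.D) 1

/-- Well-posedness of the upper interconnection `F_U(M, Δ)`. -/
def WellPosed (M : LTISystem X (W ⊕ Dd) (V ⊕ E)) (Δ : LTISystem XΔ V W) : Prop :=
  IsUnit (loopMatrix M Δ)

/-- The system `F_U(M, Δ)` from `d` to `e` with state `(x, x^Δ)`, obtained by solving the loop
equations `loopMatrix M Δ (v, w) = (C_v x + D_vd d, C_Δ x^Δ)` for `(v, w)`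
(meaningful when the interconnection is well-posed). -/
noncomputable def upperLFT (M : LTISystem X (W ⊕ Dd) (V ⊕ E)) (Δ : LTISystem XΔ V W) :
    LTISystem (X ⊕ XΔ) Dd E where
  A := Matrix.fromBlocks M.A 0 0 Δ.A
    + Matrix.fromBlocks 0 M.B.toCols₁ Δ.B 0 * (loopMatrix M Δ)⁻¹
      * Matrix.fromBlocks M.C.toRows₁ 0 0 Δ.C
  B := Matrix.fromRows M.B.toCols₂ (0 : Matrix XΔ Dd ℝ)
    + Matrix.fromBlocks 0 M.B.toCols₁ Δ.B 0 * (loopMatrix M Δ)⁻¹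
      * Matrix.fromRows M.D.toBlocks₁₂ (0 : Matrix W Dd ℝ)
  C := Matrix.fromCols M.C.toRows₂ (0 : Matrix E XΔ ℝ)
    + Matrix.fromCols (0 : Matrix E V ℝ) M.D.toBlocks₂₁ * (loopMatrix M Δ)⁻¹
      * Matrix.fromBlocks M.C.toRows₁ 0 0 Δ.C
  D := M.D.toBlocks₂₂
    + Matrix.fromCols (0 : Matrix E V ℝ) M.D.toBlocks₂₁ * (loopMatrix M Δ)⁻¹
      * Matrix.fromRows M.D.toBlocks₁₂ (0 : Matrix W Dd ℝ)

end Interconnection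

end LTISystem

/-- The scaled matrix `diag(s I, I) N diag(s⁻¹ I, I)` for a real scalar `s`. -/
noncomputable def scaledMatrix {W Dd V E : Type*}
    [Fintype W] [DecidableEq W] [Fintype Dd] [DecidableEq Dd]
    [Fintype V] [DecidableEq V] [Fintype E] [DecidableEq E]
    (s : ℝ) (N : Matrix (V ⊕ E) (W ⊕ Dd) ℂ) : Matrix (V ⊕ E) (W ⊕ Dd) ℂ :=
  Matrix.fromBlocks ((s : ℂ) • (1 : Matrix V V ℂ)) 0 0 (1 : Matrix E E ℂ) * N
    * Matrix.fromBlocks ((s : ℂ)⁻¹ • (1 : Matrix W W ℂ)) 0 0 (1 : Matrix Dd Dd ℂ)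

/-! Both statements are compared on the unit circle through phasors: complex amplitudes of signals
proportional to z ^ t. At a point z, the scaled bound says that s²|v|² + |e|² < s²|w|² + |d|² for
every nonzero (w, d) with M(z)(w, d) = (v, e) (`sigmaMax_scaledMatrix_lt_one_iff`).

From (A) to (B): if w = Δ(z)v, then |w| ≤ |v|, and the weighted inequality leaves |e| < |d|. With d
= 0 it also shows that the loop closed with tΔ, 0 ≤ t ≤ 1, has no nonzero mode on the circle. The
return-difference determinant, written in ζ = 1/z, is entire. It has no zero in the closed disc at t
= 0, where the loop is open, and keeps this property up to t = 1 (`ne_zero_of_homotopy`). Its value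
at ζ = 0 gives well-posedness, the rest of the disc gives stability.

From (B) to (A): if some nonzero (w, d) had |w| ≤ |v| and |e| ≥ |d| at z, a stable contraction Δ
with Δ(z)v = w (`exists_interpolant`) would violate (B). So |v|² - |w|² and |e|² - |d|² are never
both nonnegative away from zero, and the S-lemma (`exists_pos_forall_neg`) provides a multiplier s².
At z = ±1 a real Δ interpolates only real data. There the S-lemma is used on real vectors, and the
inequality extends to complex ones by adding real and imaginary parts. No regularity of the scaling
in θ is required, so each frequency is treated separately. -/

/-! ### Squared norms and contractions -/

/-- The squared Euclidean norm of a complex coordinate vector. -/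
noncomputable def l2sq {ι : Type*} [Fintype ι] (x : ι → ℂ) : ℝ := ∑ i, ‖x i‖ ^ 2

section l2sq

variable {ι κ : Type*} [Fintype ι] [Fintype κ]

theorem l2sq_nonneg (x : ι → ℂ) : 0 ≤ l2sq x := Finset.sum_nonneg fun _ _ => by positivity

theorem l2sq_eq_norm_sq (x : ι → ℂ) : l2sq x = ‖WithLp.toLp 2 x‖ ^ 2 := by
  rw [EuclideanSpace.norm_sq_eq]; rfl

@[simp] theorem l2sq_zero : l2sq (0 : ι → ℂ) = 0 := by simp [l2sq]

theorem l2sq_eq_zero {x : ι → ℂ} : l2sq x = 0 ↔ x = 0 := by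
  rw [l2sq_eq_norm_sq]; simp

theorem l2sq_pos {x : ι → ℂ} (hx : x ≠ 0) : 0 < l2sq x :=
  lt_of_le_of_ne (l2sq_nonneg x) fun h => hx (l2sq_eq_zero.1 h.symm)

theorem l2sq_smul (c : ℂ) (x : ι → ℂ) : l2sq (c • x) = ‖c‖ ^ 2 * l2sq x := by
  simp [l2sq, mul_pow, Finset.mul_sum]

theorem l2sq_sum_type (x : ι ⊕ κ → ℂ) :
    l2sq x = l2sq (fun i => x (Sum.inl i)) + l2sq (fun i => x (Sum.inr i)) :=
  Fintype.sum_sum_type _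

theorem l2sq_re_add_im (x : ι → ℂ) :
    l2sq x = l2sq (fun i => ((x i).re : ℂ)) + l2sq (fun i => ((x i).im : ℂ)) := by
  simp only [l2sq, ← Finset.sum_add_distrib]
  refine Finset.sum_congr rfl fun i _ => ?_
  rw [← Complex.normSq_eq_norm_sq, Complex.normSq_apply]
  simp [sq]

variable [DecidableEq ι]

theorem sigmaMax_le_one_iff (A : Matrix κ ι ℂ) :
    sigmaMax A ≤ 1 ↔ ∀ x, l2sq (A.mulVec x) ≤ l2sq x := by
  constructor
  · intro h x
    rw [l2sq_eq_norm_sq, l2sq_eq_norm_sq]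
    have h1 := (LinearMap.toContinuousLinearMap (Matrix.toEuclideanLin A)).le_opNorm
      (WithLp.toLp 2 x)
    have h2 : ‖WithLp.toLp 2 (A.mulVec x)‖ ≤ sigmaMax A * ‖WithLp.toLp 2 x‖ := h1
    have h3 : ‖WithLp.toLp 2 (A.mulVec x)‖ ≤ ‖WithLp.toLp 2 x‖ :=
      h2.trans (mul_le_of_le_one_left (norm_nonneg _) h)
    gcongr
  · intro h
    refine ContinuousLinearMap.opNorm_le_bound _ zero_le_one fun x => ?_
    have h1 := h (WithLp.ofLp x)
    rw [l2sq_eq_norm_sq, l2sq_eq_norm_sq] at h1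
    rw [one_mul]
    exact le_of_sq_le_sq h1 (norm_nonneg _)

/-- By compactness of the unit sphere the norm is attained, so a strict inequality at each vector
gives a strict inequality for the norm. An empty index type has no unit vector and is treated apart.
-/
theorem sigmaMax_lt_one_iff (A : Matrix κ ι ℂ) :
    sigmaMax A < 1 ↔ ∀ x, x ≠ 0 → l2sq (A.mulVec x) < l2sq x := by
  constructor
  · intro h x hx
    rw [l2sq_eq_norm_sq, l2sq_eq_norm_sq]
    have hpos : 0 < ‖WithLp.toLp 2 x‖ := norm_pos_iff.2 (by simpa using hx)
    have h2 : ‖WithLp.toLp 2 (A.mulVec x)‖ ≤ sigmaMax A * ‖WithLp.toLp 2 x‖ :=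
      (LinearMap.toContinuousLinearMap (Matrix.toEuclideanLin A)).le_opNorm (WithLp.toLp 2 x)
    have h3 : ‖WithLp.toLp 2 (A.mulVec x)‖ < ‖WithLp.toLp 2 x‖ :=
      h2.trans_lt (mul_lt_of_lt_one_left hpos h)
    gcongr
  · intro h
    set T := LinearMap.toContinuousLinearMap (Matrix.toEuclideanLin A) with hT
    rcases isEmpty_or_nonempty ι with hι | hι
    · have : sigmaMax A ≤ 0 := by
        refine ContinuousLinearMap.opNorm_le_bound _ le_rfl fun x => ?_
        simp [Subsingleton.elim x 0]
      linarith
    · have hne : (Metric.sphere (0 : EuclideanSpace ℂ ι) 1).Nonempty :=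
        NormedSpace.sphere_nonempty.2 zero_le_one
      obtain ⟨x₀, hx₀, hmax⟩ := (isCompact_sphere (0 : EuclideanSpace ℂ ι) 1).exists_isMaxOn hne
        (T.continuous.norm.continuousOn)
      have hlt : ∀ x : EuclideanSpace ℂ ι, x ≠ 0 → ‖T x‖ < ‖x‖ := by
        intro x hx
        have h1 := h (WithLp.ofLp x) (by simpa using hx)
        rw [l2sq_eq_norm_sq, l2sq_eq_norm_sq] at h1
        exact lt_of_pow_lt_pow_left₀ 2 (norm_nonneg _) h1
      have hx₀1 : ‖x₀‖ = 1 := by simpa using hx₀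
      have h1 : ‖T x₀‖ < 1 := by
        have := hlt x₀ (by rintro rfl; simp at hx₀1)
        rwa [hx₀1] at this
      refine lt_of_le_of_lt (ContinuousLinearMap.opNorm_le_of_unit_norm (norm_nonneg (T x₀)) ?_) h1
      intro x hx
      exact hmax (by simpa using hx)

end l2sq

/-! ### The S-lemma -/

section SLemma

variable {E : Type*} [NormedAddCommGroup E] [NormedSpace ℝ E]

/-- If `(1 - l) q₁ + l q₂ ≥ 0` at two points, `q₁ < 0` at the first and `q₂ < 0` at the second,
then `q₁` and `q₂` are both nonnegative at some nonzero point. -/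
theorem exists_nonneg_nonneg_of_segment (q₁ q₂ : QuadraticForm ℝ E) (h₁ : Continuous q₁)
    {l : ℝ} (hl0 : 0 ≤ l) (hl1 : l ≤ 1) {x y : E}
    (hx : 0 ≤ (1 - l) * q₁ x + l * q₂ x) (hy : 0 ≤ (1 - l) * q₁ y + l * q₂ y)
    (hx1 : q₁ x < 0) (hy1 : 0 ≤ q₁ y) (hy0 : y ≠ 0) :
    ∃ z, z ≠ 0 ∧ 0 ≤ q₁ z ∧ 0 ≤ q₂ z := by
  have hl : 0 < l := by
    rcases hl0.lt_or_eq with h | h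
    · exact h
    · subst h; linarith
  -- When the polar term is nonnegative, the pencil (1 - l) q₁ + l q₂ is nonnegative on the whole
  -- segment from x to y. At a zero of q₁ on that segment it reduces to l q₂, and l > 0.
  have key : ∀ y : E, y ≠ 0 → 0 ≤ (1 - l) * q₁ y + l * q₂ y → 0 ≤ q₁ y →
      0 ≤ (1 - l) * QuadraticMap.polar q₁ x y + l * QuadraticMap.polar q₂ x y →
      ∃ z, z ≠ 0 ∧ 0 ≤ q₁ z ∧ 0 ≤ q₂ z := by
    intro y hy0 hy hy1 hp
    have hcont : ContinuousOn (fun t : ℝ => q₁ ((1 - t) • x + t • y)) (Set.Icc 0 1) := by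
      apply Continuous.continuousOn
      exact h₁.comp (by fun_prop)
    obtain ⟨t, ⟨ht0, ht1⟩, ht⟩ := intermediate_value_Icc zero_le_one hcont
      (show (0 : ℝ) ∈ Set.Icc _ _ by simpa using ⟨hx1.le, hy1⟩)
    have e : ∀ q : QuadraticForm ℝ E, q ((1 - t) • x + t • y)
        = (1 - t) * (1 - t) * q x + t * t * q y + (1 - t) * t * QuadraticMap.polar q x y := by
      intro q
      rw [QuadraticMap.map_add (⇑q), QuadraticMap.map_smul, QuadraticMap.map_smul,
        QuadraticMap.polar_smul_left, QuadraticMap.polar_smul_right]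
      simp only [smul_eq_mul]; ring
    refine ⟨(1 - t) • x + t • y, ?_, ht.ge, ?_⟩
    -- A segment through the origin would make (1 - t) x and t y opposite vectors, on which q₁ takes
    -- equal values; but q₁ is negative at x and nonnegative at y.
    · intro h0
      have ht1' : t ≠ 1 := by
        rintro rfl
        exact hy0 (by simpa using h0)
      have h2 : (1 - t) • x = -(t • y) := eq_neg_of_add_eq_zero_left h0
      have h3 := congrArg q₁ h2
      rw [QuadraticMap.map_neg, QuadraticMap.map_smul, QuadraticMap.map_smul] at h3
      simp only [smul_eq_mul] at h3
      have h4 : 0 < 1 - t := sub_pos.2 (lt_of_le_of_ne ht1 ht1')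
      have h5 : (1 - t) * (1 - t) * q₁ x < 0 := mul_neg_of_pos_of_neg (mul_pos h4 h4) hx1
      have h6 : 0 ≤ t * t * q₁ y := mul_nonneg (mul_nonneg ht0 ht0) hy1
      linarith
    · have h7 : 0 ≤ l * q₂ ((1 - t) • x + t • y) := by
        have h8 : (1 - l) * q₁ ((1 - t) • x + t • y) + l * q₂ ((1 - t) • x + t • y)
            = (1 - t) * (1 - t) * ((1 - l) * q₁ x + l * q₂ x)
              + t * t * ((1 - l) * q₁ y + l * q₂ y)
              + (1 - t) * t * ((1 - l) * QuadraticMap.polar q₁ x y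
                + l * QuadraticMap.polar q₂ x y) := by
          rw [e q₁, e q₂]; ring
        have h9 : q₁ ((1 - t) • x + t • y) = 0 := ht
        rw [h9, mul_zero, zero_add] at h8
        rw [h8]
        have : 0 ≤ 1 - t := by linarith
        positivity
      exact nonneg_of_mul_nonneg_right h7 hl
  -- Replacing y by -y changes the sign of the polar term and nothing else.
  rcases le_total 0 ((1 - l) * QuadraticMap.polar q₁ x y + l * QuadraticMap.polar q₂ x y)
    with hp | hp
  · exact key y hy0 hy hy1 hp
  · refine key (-y) (neg_ne_zero.2 hy0) (by simpa using hy) (by simpa using hy1) ?_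
    rw [QuadraticMap.polar_neg_right, QuadraticMap.polar_neg_right]
    linarith

/-- The S-lemma: two quadratic forms with no common nonnegative direction have a positive
combination which is negative definite. -/
theorem exists_pos_forall_neg [ProperSpace E] (q₁ q₂ : QuadraticForm ℝ E) (h₁ : Continuous q₁)
    (h₂ : Continuous q₂) (h : ∀ x, x ≠ 0 → 0 ≤ q₁ x → q₂ x < 0) :
    ∃ t : ℝ, 0 < t ∧ ∀ x, x ≠ 0 → t * q₁ x + q₂ x < 0 := by
  -- Parameters that have a unit witness for p. Compactness of the sphere makes this set closed
  -- whenever p is a closed condition.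
  let K (p : ℝ → E → Prop) : Set ℝ := {l | l ∈ Set.Icc (0 : ℝ) 1 ∧ ∃ x, ‖x‖ = 1 ∧ p l x}
  have hK : ∀ p : ℝ → E → Prop, IsClosed {a : ℝ × E | p a.1 a.2} → IsClosed (K p) := by
    intro p hp
    have hc : IsCompact ((Set.Icc (0 : ℝ) 1 ×ˢ Metric.sphere (0 : E) 1) ∩ {a | p a.1 a.2}) :=
      (isCompact_Icc.prod (isCompact_sphere _ _)).inter_right hp
    have : K p = Prod.fst ''
        ((Set.Icc (0 : ℝ) 1 ×ˢ Metric.sphere (0 : E) 1) ∩ {a | p a.1 a.2}) := by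
      ext l
      constructor
      · rintro ⟨hl, x, hx, hpx⟩
        exact ⟨(l, x), ⟨⟨hl, by simpa using hx⟩, hpx⟩, rfl⟩
      · rintro ⟨⟨l', x⟩, ⟨⟨hl, hx⟩, hpx⟩, rfl⟩
        exact ⟨hl, x, by simpa using hx, hpx⟩
    rw [this]
    exact (hc.image continuous_fst).isClosed
  have hcl : IsClosed {a : ℝ × E | 0 ≤ (1 - a.1) * q₁ a.2 + a.1 * q₂ a.2} :=
    isClosed_le (by fun_prop) (by fun_prop)
  by_contra hcon
  push Not at hcon
  -- The failure of the multiplier (1 - l) / l, multiplied by l, becomes a statement on the pencil.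
  -- This turns the unbounded range of multipliers into (0, 1), whose closure is compact.
  have hIoo : Set.Ioo (0 : ℝ) 1 ⊆ K fun l x => 0 ≤ (1 - l) * q₁ x + l * q₂ x := by
    rintro l ⟨hl0, hl1⟩
    obtain ⟨x, hx, hq⟩ := hcon ((1 - l) / l) (div_pos (by linarith) hl0)
    have hn : 0 < ‖x‖ := norm_pos_iff.2 hx
    refine ⟨⟨hl0.le, hl1.le⟩, ‖x‖⁻¹ • x, ?_, ?_⟩
    · rw [norm_smul, norm_inv, norm_norm, inv_mul_cancel₀ hn.ne']
    · beta_reduce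
      rw [QuadraticMap.map_smul, QuadraticMap.map_smul]
      simp only [smul_eq_mul]
      have h3 : 0 ≤ l * ((1 - l) / l * q₁ x + q₂ x) := mul_nonneg hl0.le hq
      have h4 : l * ((1 - l) / l * q₁ x + q₂ x) = (1 - l) * q₁ x + l * q₂ x := by
        field_simp
      rw [h4] at h3
      have : 0 ≤ ‖x‖⁻¹ * ‖x‖⁻¹ * ((1 - l) * q₁ x + l * q₂ x) := by positivity
      linarith
  have hIcc : Set.Icc (0 : ℝ) 1 ⊆ K fun l x => 0 ≤ (1 - l) * q₁ x + l * q₂ x := by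
    rw [← closure_Ioo (zero_ne_one' ℝ)]
    exact closure_minimal hIoo (hK _ hcl)
  have c1 : IsClosed (K fun l x => 0 ≤ (1 - l) * q₁ x + l * q₂ x ∧ 0 ≤ q₁ x) :=
    hK _ (hcl.inter (isClosed_le continuous_const (h₁.comp continuous_snd)))
  have c2 : IsClosed (K fun l x => 0 ≤ (1 - l) * q₁ x + l * q₂ x ∧ 0 ≤ q₂ x) :=
    hK _ (hcl.inter (isClosed_le continuous_const (h₂.comp continuous_snd)))
  -- A nonnegative value of the pencil forces q₁ ≥ 0 or q₂ ≥ 0 at its witness, so two closed sets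
  -- cover [0, 1]. The first contains 0, the second contains 1. Connectedness gives one l with a
  -- witness of each kind.
  obtain ⟨l, hl, ⟨-, y, hy, hy0, hy1⟩, ⟨-, x, hx, hx0, hx1⟩⟩ :=
    isPreconnected_closed_iff.1 (isPreconnected_Icc (a := (0 : ℝ)) (b := 1)) _ _ c1 c2
      (by
        intro l hl
        obtain ⟨-, x, hx, hq⟩ := hIcc hl
        by_cases h3 : 0 ≤ q₁ x
        · exact Or.inl ⟨hl, x, hx, hq, h3⟩
        · refine Or.inr ⟨hl, x, hx, hq, ?_⟩
          by_contra h4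
          push Not at h3 h4
          rcases hl.1.lt_or_eq with h5 | h5
          · have := mul_neg_of_pos_of_neg h5 h4
            have := mul_nonpos_of_nonneg_of_nonpos (sub_nonneg.2 hl.2) h3.le
            linarith
          · subst h5; linarith)
      (by
        have h0 : (0 : ℝ) ∈ Set.Icc (0 : ℝ) 1 := by simp
        obtain ⟨-, x, hx, hq⟩ := hIcc h0
        exact ⟨0, h0, h0, x, hx, hq, by simpa using hq⟩)
      (by
        have h0 : (1 : ℝ) ∈ Set.Icc (0 : ℝ) 1 := by simp
        obtain ⟨-, x, hx, hq⟩ := hIcc h0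
        exact ⟨1, h0, h0, x, hx, hq, by simpa using hq⟩)
  have hx' : x ≠ 0 := by rintro rfl; simp at hx
  have hq1 : q₁ x < 0 := by
    by_contra h3
    exact absurd (h x hx' (not_lt.1 h3)) (not_lt.2 hx1)
  obtain ⟨z, hz, hz1, hz2⟩ := exists_nonneg_nonneg_of_segment q₁ q₂ h₁ hl.1 hl.2 hx0 hy0 hq1 hy1
    (by rintro rfl; simp at hy)
  exact absurd (h z hz hz1) (not_lt.2 hz2)

end SLemma

/-! ### Zeros of a homotopy of holomorphic functions -/

/-- A continuous family of holomorphic functions on the disc which has no zero on the circle keeps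
having no zero in the closed disc. -/
theorem ne_zero_of_homotopy (Q : ℝ → ℂ → ℂ) (hQ : Continuous fun a : ℝ × ℂ => Q a.1 a.2)
    (hd : ∀ t, Differentiable ℂ (Q t))
    (h0 : ∀ z : ℂ, ‖z‖ ≤ 1 → Q 0 z ≠ 0)
    (hS : ∀ t ∈ Set.Icc (0 : ℝ) 1, ∀ z : ℂ, ‖z‖ = 1 → Q t z ≠ 0) :
    ∀ z : ℂ, ‖z‖ ≤ 1 → Q 1 z ≠ 0 := by
  have hcomp : IsCompact (Set.Icc (0 : ℝ) 1 ×ˢ Metric.sphere (0 : ℂ) 1) :=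
    isCompact_Icc.prod (isCompact_sphere _ _)
  obtain ⟨m, hm, hmin⟩ : ∃ m : ℝ, 0 < m ∧
      ∀ t ∈ Set.Icc (0 : ℝ) 1, ∀ z : ℂ, ‖z‖ = 1 → m ≤ ‖Q t z‖ := by
    obtain ⟨a, ha, hmin⟩ := hcomp.exists_isMinOn ⟨(0, 1), by simp⟩ hQ.norm.continuousOn
    refine ⟨‖Q a.1 a.2‖, norm_pos_iff.2 (hS _ ha.1 _ (by simpa using ha.2)), fun t ht z hz => ?_⟩
    exact hmin (show (t, z) ∈ _ from ⟨ht, by simpa using hz⟩)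
  -- The maximum principle for 1 / Q t: a zero-free Q t satisfies |Q t| ≥ m on the disc, with m
  -- independent of t. Hence being zero-free is a closed condition on t, as is having a zero.
  have hmod : ∀ t ∈ Set.Icc (0 : ℝ) 1, (∀ z : ℂ, ‖z‖ ≤ 1 → Q t z ≠ 0) →
      ∀ z : ℂ, ‖z‖ ≤ 1 → m ≤ ‖Q t z‖ := by
    intro t ht hne z hz
    have hdiff : DiffContOnCl ℂ (fun z => (Q t z)⁻¹) (Metric.ball (0 : ℂ) 1) := by
      apply DifferentiableOn.diffContOnCl
      rw [closure_ball _ one_ne_zero]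
      intro z hz
      exact ((hd t z).inv (hne z (by simpa using hz))).differentiableWithinAt
    have := Complex.norm_le_of_forall_mem_frontier_norm_le (Metric.isBounded_ball) hdiff
      (C := m⁻¹) (by
        intro z hz
        rw [frontier_ball _ one_ne_zero] at hz
        rw [norm_inv]
        exact inv_anti₀ hm (hmin t ht z (by simpa using hz)))
      (z := z) (by rw [closure_ball _ one_ne_zero]; simpa using hz)
    rw [norm_inv] at this
    exact (inv_le_inv₀ (norm_pos_iff.2 (hne z hz)) hm).1 this
  let G : Set ℝ := {t | ∀ z : ℂ, ‖z‖ ≤ 1 → m ≤ ‖Q t z‖}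
  let F : Set ℝ := {t | ∃ z : ℂ, ‖z‖ ≤ 1 ∧ t ∈ Set.Icc (0 : ℝ) 1 ∧ Q t z = 0}
  have hG : IsClosed G := by
    have : G = ⋂ z : ℂ, ⋂ (_ : ‖z‖ ≤ 1), {t | m ≤ ‖Q t z‖} := by ext; simp [G]
    rw [this]
    refine isClosed_iInter fun z => isClosed_iInter fun _ => ?_
    exact isClosed_le continuous_const
      (hQ.comp (continuous_id.prodMk continuous_const)).norm
  have hF : IsClosed F := by
    have hc : IsCompact ((Set.Icc (0 : ℝ) 1 ×ˢ Metric.closedBall (0 : ℂ) 1) ∩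
        {a | Q a.1 a.2 = 0}) :=
      (isCompact_Icc.prod (isCompact_closedBall _ _)).inter_right
        (isClosed_eq hQ continuous_const)
    have : F = Prod.fst '' ((Set.Icc (0 : ℝ) 1 ×ˢ Metric.closedBall (0 : ℂ) 1) ∩
        {a | Q a.1 a.2 = 0}) := by
      ext t
      constructor
      · rintro ⟨z, hz, ht, h⟩
        exact ⟨(t, z), ⟨⟨ht, by simpa using hz⟩, h⟩, rfl⟩
      · rintro ⟨⟨t', z⟩, ⟨⟨ht, hz⟩, h⟩, rfl⟩
        exact ⟨z, by simpa using hz, ht, h⟩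
    rw [this]
    exact (hc.image continuous_fst).isClosed
  intro z hz hz0
  obtain ⟨t, ht, htG, w, hw, -, hw0⟩ :=
    isPreconnected_closed_iff.1 (isPreconnected_Icc (a := (0 : ℝ)) (b := 1)) G F hG hF
      (by
        intro t ht
        by_cases h : ∀ z : ℂ, ‖z‖ ≤ 1 → Q t z ≠ 0
        · exact Or.inl (hmod t ht h)
        · push Not at h
          obtain ⟨z, hz, h⟩ := h
          exact Or.inr ⟨z, hz, ht, h⟩)
      ⟨0, by simp, hmod 0 (by simp) h0⟩
      ⟨1, by simp, z, hz, by simp, hz0⟩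
  have := htG w hw
  rw [hw0, norm_zero] at this
  linarith

/-- A matrix-valued function with differentiable entries has differentiable determinant. -/
theorem differentiable_det {n : Type*} [Fintype n] [DecidableEq n] (N : ℂ → Matrix n n ℂ)
    (h : ∀ i j, Differentiable ℂ fun z => N z i j) : Differentiable ℂ fun z => (N z).det := by
  simp only [Matrix.det_apply]
  refine Differentiable.fun_sum fun σ _ => Differentiable.const_smul ?_ _
  exact Differentiable.fun_finsetProd fun i _ => h _ _

/-! ### Modes, phasors and the norm on the circle -/

namespace LTISystem

section Basic

open Matrix

variable {X U Y : Type*} [Fintype X] [DecidableEq X]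

theorem mem_spectrum_iff (G : LTISystem X U Y) (z : ℂ) :
    z ∈ spectrum ℂ (G.A.map Complex.ofReal) ↔
      ∃ x : X → ℂ, x ≠ 0 ∧ z • x = G.A.map Complex.ofReal *ᵥ x := by
  rw [spectrum.mem_iff, Algebra.algebraMap_eq_smul_one, Matrix.isUnit_iff_isUnit_det,
    isUnit_iff_ne_zero, not_not, ← Matrix.exists_mulVec_eq_zero_iff]
  simp only [sub_mulVec, smul_mulVec, one_mulVec, sub_eq_zero, ne_eq]

/-- Stability means that there are no nonzero modes outside the open unit disc. -/
theorem stable_iff (G : LTISystem X U Y) :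
    G.Stable ↔ ∀ z : ℂ, 1 ≤ ‖z‖ → ∀ x : X → ℂ, z • x = G.A.map Complex.ofReal *ᵥ x → x = 0 := by
  constructor
  · intro h z hz x hx
    by_contra h0
    have hmem := (G.mem_spectrum_iff z).2 ⟨x, h0, hx⟩
    have hle : (‖z‖₊ : ENNReal) ≤ spectralRadius ℂ (G.A.map Complex.ofReal) :=
      le_iSup₂ (f := fun k (_ : k ∈ spectrum ℂ (G.A.map Complex.ofReal)) => (‖k‖₊ : ENNReal))
        _ hmem
    have h1 : (1 : ENNReal) ≤ ‖z‖₊ := by exact_mod_cast hz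
    exact absurd (lt_of_le_of_lt (h1.trans hle) h) (lt_irrefl _)
  · intro h
    rcases isEmpty_or_nonempty X with hX | hX
    · unfold Stable
      simp [spectralRadius, spectrum.of_subsingleton]
    -- The choice of norm is immaterial: a Banach algebra structure ensures that a strict bound on
    -- each eigenvalue bounds the spectral radius strictly.
    · let _ := Matrix.linftyOpNormedRing (n := X) (α := ℂ)
      let _ := Matrix.linftyOpNormedAlgebra (n := X) (R := ℂ) (α := ℂ)
      refine spectrum.spectralRadius_lt_of_forall_lt (G.A.map Complex.ofReal) (r := 1) ?_
      intro z hz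
      obtain ⟨x, h0, hx⟩ := (G.mem_spectrum_iff z).1 hz
      by_contra hlt
      exact h0 (h z (by exact_mod_cast not_lt.1 hlt) x hx)

/-- Here ζ stands for 1/z, so that ζ = 0 includes the point at infinity. -/
theorem Stable.eq_zero_of_eq_smul {G : LTISystem X U Y} (hG : G.Stable) {ζ : ℂ} (hζ : ‖ζ‖ ≤ 1)
    {x : X → ℂ} (hx : x = ζ • (G.A.map Complex.ofReal *ᵥ x)) : x = 0 := by
  rcases eq_or_ne ζ 0 with rfl | h0
  · simpa using hx
  · refine G.stable_iff.1 hG ζ⁻¹ ?_ x ?_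
    · rw [norm_inv]
      exact (one_le_inv₀ (norm_pos_iff.2 h0)).2 hζ
    · conv_lhs => rw [hx, smul_smul, inv_mul_cancel₀ h0, one_smul]

theorem Stable.isUnit_sub {G : LTISystem X U Y} (hG : G.Stable) {z : ℂ} (hz : 1 ≤ ‖z‖) :
    IsUnit (z • (1 : Matrix X X ℂ) - G.A.map Complex.ofReal).det := by
  rw [isUnit_iff_ne_zero]
  intro h
  obtain ⟨x, h0, hx⟩ := Matrix.exists_mulVec_eq_zero_iff.2 h
  rw [sub_mulVec, smul_mulVec, one_mulVec, sub_eq_zero] at hx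
  exact h0 (G.stable_iff.1 hG z hz x hx)

variable [Fintype U]

/-- The signals `z ^ t • x`, `z ^ t • u`, `z ^ t • y` form a trajectory of `G`. -/
def IsPhasor (G : LTISystem X U Y) (z : ℂ) (x : X → ℂ) (u : U → ℂ) (y : Y → ℂ) : Prop :=
  z • x = G.A.map Complex.ofReal *ᵥ x + G.B.map Complex.ofReal *ᵥ u ∧
    y = G.C.map Complex.ofReal *ᵥ x + G.D.map Complex.ofReal *ᵥ u

theorem IsPhasor.eq_transfer {G : LTISystem X U Y} {z : ℂ} {x : X → ℂ} {u : U → ℂ} {y : Y → ℂ}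
    (h : G.IsPhasor z x u y) (hG : G.Stable) (hz : 1 ≤ ‖z‖) : y = G.transfer z *ᵥ u := by
  have h1 : (z • (1 : Matrix X X ℂ) - G.A.map Complex.ofReal) *ᵥ x
      = G.B.map Complex.ofReal *ᵥ u := by
    rw [sub_mulVec, smul_mulVec, one_mulVec, h.1, add_sub_cancel_left]
  rw [transfer, add_mulVec, ← mulVec_mulVec, ← h1, ← mulVec_mulVec, mulVec_mulVec _ _⁻¹,
    Matrix.nonsing_inv_mul _ (hG.isUnit_sub hz), one_mulVec, h.2]

theorem exists_isPhasor {G : LTISystem X U Y} (hG : G.Stable) {z : ℂ} (hz : 1 ≤ ‖z‖)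
    (u : U → ℂ) : ∃ x, G.IsPhasor z x u (G.transfer z *ᵥ u) := by
  have h : ∃ x, z • x = G.A.map Complex.ofReal *ᵥ x + G.B.map Complex.ofReal *ᵥ u := by
    refine ⟨(z • (1 : Matrix X X ℂ) - G.A.map Complex.ofReal)⁻¹ *ᵥ
      (G.B.map Complex.ofReal *ᵥ u), ?_⟩
    rw [← sub_eq_iff_eq_add']
    conv_lhs => enter [1]; rw [← one_mulVec ((_ : Matrix X X ℂ) *ᵥ _)]
    rw [← smul_mulVec, ← sub_mulVec, mulVec_mulVec, Matrix.mul_nonsing_inv _ (hG.isUnit_sub hz),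
      one_mulVec]
  obtain ⟨x, hx⟩ := h
  have hp : G.IsPhasor z x u (G.C.map Complex.ofReal *ᵥ x + G.D.map Complex.ofReal *ᵥ u) :=
    ⟨hx, rfl⟩
  exact ⟨x, hp.eq_transfer hG hz ▸ hp⟩

variable [DecidableEq U] [Fintype Y]

theorem exists_exp_eq {z : ℂ} (hz : ‖z‖ = 1) :
    ∃ θ ∈ Set.Icc 0 (2 * Real.pi), Complex.exp (θ * Complex.I) = z := by
  obtain ⟨t, ht⟩ := (Complex.norm_eq_one_iff z).1 hz
  refine ⟨toIcoMod Real.two_pi_pos 0 t, ?_, ?_⟩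
  · have := toIcoMod_mem_Ico Real.two_pi_pos 0 t
    rw [zero_add] at this
    exact ⟨this.1, this.2.le⟩
  · rw [← ht, toIcoMod, Complex.exp_eq_exp_iff_exists_int]
    refine ⟨-toIcoDiv Real.two_pi_pos 0 t, ?_⟩
    push_cast [zsmul_eq_mul]
    ring

theorem hinfNorm_le_one_iff {G : LTISystem X U Y} (hG : G.Stable) :
    G.hinfNorm ≤ 1 ↔ ∀ z : ℂ, ‖z‖ = 1 → sigmaMax (G.transfer z) ≤ 1 := by
  obtain ⟨⟨θ₀, h₀, hθ₀⟩, hub⟩ := G.isGreatest_hinfNorm hG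
  constructor
  · intro h z hz
    obtain ⟨θ, hθ, rfl⟩ := exists_exp_eq hz
    exact (hub ⟨θ, hθ, rfl⟩).trans h
  · intro h
    rw [← hθ₀]
    exact h _ (Complex.norm_exp_ofReal_mul_I θ₀)

/-- Strictness survives the supremum because it is attained at some frequency. -/
theorem hinfNorm_lt_one_iff {G : LTISystem X U Y} (hG : G.Stable) :
    G.hinfNorm < 1 ↔ ∀ z : ℂ, ‖z‖ = 1 → sigmaMax (G.transfer z) < 1 := by
  obtain ⟨⟨θ₀, h₀, hθ₀⟩, hub⟩ := G.isGreatest_hinfNorm hG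
  constructor
  · intro h z hz
    obtain ⟨θ, hθ, rfl⟩ := exists_exp_eq hz
    exact (hub ⟨θ, hθ, rfl⟩).trans_lt h
  · intro h
    rw [← hθ₀]
    exact h _ (Complex.norm_exp_ofReal_mul_I θ₀)

end Basic

/-! ### Phasors of the closed loop -/

section Interconnection

open Matrix

/-- The phasor equations of a system with partitioned input and output. -/
theorem isPhasor_sum_iff {X W Dd V E : Type*} [Fintype X] [Fintype W] [Fintype Dd]
    (M : LTISystem X (W ⊕ Dd) (V ⊕ E)) (z : ℂ) (x : X → ℂ) (w : W → ℂ) (d : Dd → ℂ) (v : V → ℂ) (e : E → ℂ) :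
    M.IsPhasor z x (Sum.elim w d) (Sum.elim v e) ↔
      z • x = M.A.map Complex.ofReal *ᵥ x + (M.B.toCols₁.map Complex.ofReal *ᵥ w
          + M.B.toCols₂.map Complex.ofReal *ᵥ d) ∧
        v = M.C.toRows₁.map Complex.ofReal *ᵥ x + (M.D.toBlocks₁₁.map Complex.ofReal *ᵥ w
          + M.D.toBlocks₁₂.map Complex.ofReal *ᵥ d) ∧
        e = M.C.toRows₂.map Complex.ofReal *ᵥ x + (M.D.toBlocks₂₁.map Complex.ofReal *ᵥ w
          + M.D.toBlocks₂₂.map Complex.ofReal *ᵥ d) := by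
  unfold IsPhasor
  refine and_congr ?_ ?_
  · conv_lhs => rw [← fromCols_toCols M.B, fromCols_map, fromCols_mulVec_sumElim]
  · conv_lhs =>
      rw [← fromRows_toRows M.C, ← fromBlocks_toBlocks M.D, fromRows_map, fromRows_mulVec,
        fromBlocks_map, fromBlocks_mulVec]
    rw [← Sum.elim_add_add, Sum.elim_eq_iff]
    simp

variable {X XΔ W Dd V E : Type*} [Fintype W] [DecidableEq W] [Fintype V] [DecidableEq V]
  (M : LTISystem X (W ⊕ Dd) (V ⊕ E)) (Δ : LTISystem XΔ V W)

theorem loopMatrix_map_mulVec (v : V → ℂ) (w : W → ℂ) :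
    (loopMatrix M Δ).map Complex.ofReal *ᵥ Sum.elim v w
      = Sum.elim (v - M.D.toBlocks₁₁.map Complex.ofReal *ᵥ w)
        (w - Δ.D.map Complex.ofReal *ᵥ v) := by
  have h1 : (-M.D.toBlocks₁₁).map Complex.ofReal = -(M.D.toBlocks₁₁.map Complex.ofReal) := by
    ext; simp
  have h2 : (-Δ.D).map Complex.ofReal = -(Δ.D.map Complex.ofReal) := by
    ext; simp
  have h3 : (1 : Matrix V V ℝ).map Complex.ofReal = 1 := Matrix.map_one _ (by simp) (by simp)
  have h4 : (1 : Matrix W W ℝ).map Complex.ofReal = 1 := Matrix.map_one _ (by simp) (by simp)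
  rw [loopMatrix, fromBlocks_map, h1, h2, h3, h4, fromBlocks_mulVec]
  simp [neg_mulVec, sub_eq_add_neg, add_comm]

/-- A real matrix and its complexification have the same determinant, so nonsingularity can be
tested on complex amplitudes. -/
theorem wellPosed_iff_forall :
    WellPosed M Δ ↔ ∀ (v : V → ℂ) (w : W → ℂ), v = M.D.toBlocks₁₁.map Complex.ofReal *ᵥ w →
      w = Δ.D.map Complex.ofReal *ᵥ v → v = 0 ∧ w = 0 := by
  have hdet : WellPosed M Δ ↔ ((loopMatrix M Δ).map Complex.ofReal).det ≠ 0 := by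
    rw [WellPosed, Matrix.isUnit_iff_isUnit_det, isUnit_iff_ne_zero]
    have : ((loopMatrix M Δ).map Complex.ofReal).det = ((loopMatrix M Δ).det : ℂ) :=
      (RingHom.map_det Complex.ofRealHom _).symm
    rw [this]
    norm_cast
  rw [hdet, ne_eq, ← Matrix.exists_mulVec_eq_zero_iff]
  constructor
  · intro h v w hv hw
    by_contra h0
    refine h ⟨Sum.elim v w, ?_, ?_⟩
    · intro h1
      rw [← Sum.elim_zero_zero, Sum.elim_eq_iff] at h1
      exact h0 h1
    · rw [loopMatrix_map_mulVec, sub_eq_zero.2 hv, sub_eq_zero.2 hw, Sum.elim_zero_zero]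
  · rintro h ⟨p, hp, h0⟩
    have e : p = Sum.elim (p ∘ Sum.inl) (p ∘ Sum.inr) := (Sum.elim_comp_inl_inr p).symm
    rw [e, loopMatrix_map_mulVec, ← Sum.elim_zero_zero, Sum.elim_eq_iff, sub_eq_zero,
      sub_eq_zero] at h0
    obtain ⟨h1, h2⟩ := h _ _ h0.1 h0.2
    rw [h1, h2, Sum.elim_zero_zero] at e
    exact hp e

variable {M Δ}

theorem WellPosed.inv_map_mulVec (h : WellPosed M Δ) (p : V ⊕ W → ℂ) :
    (loopMatrix M Δ)⁻¹.map Complex.ofReal *ᵥ ((loopMatrix M Δ).map Complex.ofReal *ᵥ p) = p ∧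
    (loopMatrix M Δ).map Complex.ofReal *ᵥ ((loopMatrix M Δ)⁻¹.map Complex.ofReal *ᵥ p) = p := by
  have hu := (Matrix.isUnit_iff_isUnit_det _).1 h
  have hmul : ∀ A B : Matrix (V ⊕ W) (V ⊕ W) ℝ,
      A.map Complex.ofReal * B.map Complex.ofReal = (A * B).map Complex.ofReal := fun A B =>
    (Matrix.map_mul (f := Complex.ofRealHom)).symm
  have h1 : (1 : Matrix (V ⊕ W) (V ⊕ W) ℝ).map Complex.ofReal = 1 :=
    Matrix.map_one _ (by simp) (by simp)
  rw [mulVec_mulVec, mulVec_mulVec, hmul, hmul, Matrix.nonsing_inv_mul _ hu,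
    Matrix.mul_nonsing_inv _ hu, h1, one_mulVec]
  exact ⟨rfl, rfl⟩

theorem map_ofReal_add_mul_mulVec {α β γ δ : Type*} [Fintype β] [Fintype γ] [Fintype δ]
    (P : Matrix α β ℝ) (R : Matrix α γ ℝ) (N : Matrix γ δ ℝ) (S : Matrix δ β ℝ) (u : β → ℂ) :
    (P + R * N * S).map Complex.ofReal *ᵥ u = P.map Complex.ofReal *ᵥ u
      + R.map Complex.ofReal *ᵥ (N.map Complex.ofReal *ᵥ (S.map Complex.ofReal *ᵥ u)) := by
  have e : (P + R * N * S).map Complex.ofReal = P.map Complex.ofReal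
      + R.map Complex.ofReal * N.map Complex.ofReal * S.map Complex.ofReal := by
    rw [Matrix.map_add _ (by simp)]
    congr 1
    change (R * N * S).map Complex.ofRealHom = _
    rw [Matrix.map_mul, Matrix.map_mul]
    rfl
  rw [e, add_mulVec, mulVec_mulVec, mulVec_mulVec, Matrix.mul_assoc]

variable [Fintype X] [Fintype XΔ] [Fintype Dd]

/-- The signals of `F_U(M, Δ)` are those of the loop formed by `M` and `Δ`. -/
theorem WellPosed.isPhasor_upperLFT_iff (h : WellPosed M Δ) (z : ℂ) (x : X → ℂ) (xΔ : XΔ → ℂ)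
    (d : Dd → ℂ) (e : E → ℂ) :
    (upperLFT M Δ).IsPhasor z (Sum.elim x xΔ) d e ↔ ∃ v w,
      M.IsPhasor z x (Sum.elim w d) (Sum.elim v e) ∧ Δ.IsPhasor z xΔ v w := by
  have key : ∀ v w,
      v = M.C.toRows₁.map Complex.ofReal *ᵥ x + (M.D.toBlocks₁₁.map Complex.ofReal *ᵥ w
          + M.D.toBlocks₁₂.map Complex.ofReal *ᵥ d) ∧
        w = Δ.C.map Complex.ofReal *ᵥ xΔ + Δ.D.map Complex.ofReal *ᵥ v ↔
      Sum.elim v w = (loopMatrix M Δ)⁻¹.map Complex.ofReal *ᵥ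
        (Sum.elim (M.C.toRows₁.map Complex.ofReal *ᵥ x + M.D.toBlocks₁₂.map Complex.ofReal *ᵥ d)
          (Δ.C.map Complex.ofReal *ᵥ xΔ)) := by
    intro v w
    have e1 : Sum.elim v w = (loopMatrix M Δ)⁻¹.map Complex.ofReal *ᵥ
        (Sum.elim (M.C.toRows₁.map Complex.ofReal *ᵥ x + M.D.toBlocks₁₂.map Complex.ofReal *ᵥ d)
          (Δ.C.map Complex.ofReal *ᵥ xΔ)) ↔
        (loopMatrix M Δ).map Complex.ofReal *ᵥ Sum.elim v w =
        (Sum.elim (M.C.toRows₁.map Complex.ofReal *ᵥ x + M.D.toBlocks₁₂.map Complex.ofReal *ᵥ d)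
          (Δ.C.map Complex.ofReal *ᵥ xΔ)) := by
      constructor
      · intro h1
        rw [h1, (h.inv_map_mulVec _).2]
      · intro h1
        rw [← h1, (h.inv_map_mulVec _).1]
    rw [e1, loopMatrix_map_mulVec, Sum.elim_eq_iff, sub_eq_iff_eq_add, sub_eq_iff_eq_add, add_assoc,
      add_comm (M.D.toBlocks₁₁.map Complex.ofReal *ᵥ w)]
  have main : ∀ v w, Sum.elim v w = (loopMatrix M Δ)⁻¹.map Complex.ofReal *ᵥ
        (Sum.elim (M.C.toRows₁.map Complex.ofReal *ᵥ x + M.D.toBlocks₁₂.map Complex.ofReal *ᵥ d)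
          (Δ.C.map Complex.ofReal *ᵥ xΔ)) →
      ((upperLFT M Δ).IsPhasor z (Sum.elim x xΔ) d e ↔
        (z • x = M.A.map Complex.ofReal *ᵥ x + (M.B.toCols₁.map Complex.ofReal *ᵥ w
          + M.B.toCols₂.map Complex.ofReal *ᵥ d) ∧
        z • xΔ = Δ.A.map Complex.ofReal *ᵥ xΔ + Δ.B.map Complex.ofReal *ᵥ v) ∧
        e = M.C.toRows₂.map Complex.ofReal *ᵥ x + (M.D.toBlocks₂₁.map Complex.ofReal *ᵥ w
          + M.D.toBlocks₂₂.map Complex.ofReal *ᵥ d)) := by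
    intro v w hvw
    -- The contribution of the states is (v, w) minus that of d. Substituted into the closed-loop
    -- equations, the terms in d produced by the inverse cancel.
    have hN : (loopMatrix M Δ)⁻¹.map Complex.ofReal *ᵥ
        ((Matrix.fromBlocks M.C.toRows₁ 0 0 Δ.C).map Complex.ofReal *ᵥ Sum.elim x xΔ)
        = Sum.elim v w - (loopMatrix M Δ)⁻¹.map Complex.ofReal *ᵥ
          ((Matrix.fromRows M.D.toBlocks₁₂ (0 : Matrix W Dd ℝ)).map Complex.ofReal *ᵥ d) := by
      rw [hvw, ← mulVec_sub]
      congr 1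
      ext (i | i) <;> simp [fromBlocks_map, fromBlocks_mulVec, fromRows_map, fromRows_mulVec]
    unfold IsPhasor upperLFT
    dsimp only
    simp only [map_ofReal_add_mul_mulVec, hN, mulVec_sub]
    refine and_congr ?_ ?_
    · have e1 : z • Sum.elim x xΔ = Sum.elim (z • x) (z • xΔ) := by
        ext (i | i) <;> rfl
      rw [e1, ← Sum.elim_eq_iff]
      refine Eq.congr rfl ?_
      ext (i | i) <;>
      simp [fromBlocks_map, fromBlocks_mulVec, fromRows_map, fromRows_mulVec] <;> ring
    · refine Eq.congr rfl ?_
      ext i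
      simp [fromCols_map, fromCols_mulVec]
      ring
  constructor
  · intro hp
    obtain ⟨v, w, hvw⟩ : ∃ v w, Sum.elim v w = (loopMatrix M Δ)⁻¹.map Complex.ofReal *ᵥ
        (Sum.elim (M.C.toRows₁.map Complex.ofReal *ᵥ x + M.D.toBlocks₁₂.map Complex.ofReal *ᵥ d)
          (Δ.C.map Complex.ofReal *ᵥ xΔ)) := ⟨_, _, Sum.elim_comp_inl_inr _⟩
    have h1 := (main v w hvw).1 hp
    have h2 := (key v w).2 hvw
    exact ⟨v, w, (M.isPhasor_sum_iff ..).2 ⟨h1.1.1, h2.1, h1.2⟩, h1.1.2, h2.2⟩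
  · rintro ⟨v, w, hp, hpΔ⟩
    rw [isPhasor_sum_iff] at hp
    exact (main v w ((key v w).1 ⟨hp.2.1, hpΔ.2⟩)).2 ⟨⟨hp.1, hpΔ.1⟩, hp.2.2⟩

end Interconnection

end LTISystem

/-! ### The scaled bound as a weighted inequality -/

theorem l2sq_elim {ι κ : Type*} [Fintype ι] [Fintype κ] (a : ι → ℂ) (b : κ → ℂ) :
    l2sq (Sum.elim a b) = l2sq a + l2sq b := l2sq_sum_type _

theorem sumElim_eq_zero_iff {ι κ : Type*} (a : ι → ℂ) (b : κ → ℂ) :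
    Sum.elim a b = 0 ↔ a = 0 ∧ b = 0 := by
  rw [← Sum.elim_zero_zero, Sum.elim_eq_iff]

/-- The scaled matrix is a strict contraction if and only if the associated weighted quadratic
inequality holds. -/
theorem sigmaMax_scaledMatrix_lt_one_iff {W Dd V E : Type*}
    [Fintype W] [DecidableEq W] [Fintype Dd] [DecidableEq Dd]
    [Fintype V] [DecidableEq V] [Fintype E] [DecidableEq E]
    {s : ℝ} (hs : 0 < s) (N : Matrix (V ⊕ E) (W ⊕ Dd) ℂ) :
    sigmaMax (scaledMatrix s N) < 1 ↔ ∀ w d v e, Sum.elim w d ≠ 0 →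
      N.mulVec (Sum.elim w d) = Sum.elim v e →
        s ^ 2 * l2sq v + l2sq e < s ^ 2 * l2sq w + l2sq d := by
  have hs' : (s : ℂ) ≠ 0 := by exact_mod_cast hs.ne'
  have key : ∀ w d v e, N.mulVec (Sum.elim w d) = Sum.elim v e →
      (scaledMatrix s N).mulVec (Sum.elim ((s : ℂ) • w) d) = Sum.elim ((s : ℂ) • v) e := by
    intro w d v e h
    have h1 : (Matrix.fromBlocks ((s : ℂ)⁻¹ • (1 : Matrix W W ℂ)) 0 0
        (1 : Matrix Dd Dd ℂ)).mulVec (Sum.elim ((s : ℂ) • w) d) = Sum.elim w d := by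
      rw [Matrix.fromBlocks_mulVec]
      simp only [Sum.elim_comp_inl, Sum.elim_comp_inr, Matrix.smul_mulVec, Matrix.one_mulVec,
        Matrix.zero_mulVec, add_zero, zero_add]
      rw [smul_smul, inv_mul_cancel₀ hs', one_smul]
    rw [scaledMatrix, ← Matrix.mulVec_mulVec, h1, ← Matrix.mulVec_mulVec, h,
      Matrix.fromBlocks_mulVec]
    simp [Matrix.smul_mulVec]
  rw [sigmaMax_lt_one_iff]
  constructor
  · intro h w d v e h0 hN
    have h1 := h (Sum.elim ((s : ℂ) • w) d) (by
      rw [ne_eq, sumElim_eq_zero_iff] at h0 ⊢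
      simpa [hs.ne'] using h0)
    rw [key w d v e hN, l2sq_elim, l2sq_elim, l2sq_smul, l2sq_smul] at h1
    simpa using h1
  · intro h x hx
    obtain ⟨w, d, rfl⟩ : ∃ w d, x = Sum.elim ((s : ℂ) • w) d :=
      ⟨(s : ℂ)⁻¹ • (x ∘ Sum.inl), x ∘ Sum.inr, by
        rw [smul_smul, mul_inv_cancel₀ hs', one_smul, Sum.elim_comp_inl_inr]⟩
    have hN : N.mulVec (Sum.elim w d) = Sum.elim (N.mulVec (Sum.elim w d) ∘ Sum.inl)
      (N.mulVec (Sum.elim w d) ∘ Sum.inr) := (Sum.elim_comp_inl_inr _).symm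
    have h1 := h w d _ _ (by
      rw [ne_eq, sumElim_eq_zero_iff] at hx ⊢
      simpa [hs.ne'] using hx) hN
    rw [key w d _ _ hN, l2sq_elim, l2sq_elim, l2sq_smul, l2sq_smul]
    simpa using h1

/-! ### Robust stability by homotopy -/

namespace LTISystem

section Homotopy

open Matrix

variable {X XΔ W Dd V E : Type*}

/-- The constant gain mapping `(x, xΔ, v, w)` to `(A x + B_w w, A_Δ xΔ + B_Δ v, C_v x + D_vw w,
C_Δ xΔ + D_Δ v)`. -/
def loopGain (M : LTISystem X (W ⊕ Dd) (V ⊕ E)) (Δ : LTISystem XΔ V W) :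
    Matrix ((X ⊕ XΔ) ⊕ (V ⊕ W)) ((X ⊕ XΔ) ⊕ (V ⊕ W)) ℝ :=
  fromBlocks (fromBlocks M.A 0 0 Δ.A) (fromBlocks 0 M.B.toCols₁ Δ.B 0)
    (fromBlocks M.C.toRows₁ 0 0 Δ.C) (fromBlocks 0 M.D.toBlocks₁₁ Δ.D 0)

/-- The multiplier of the loop in which `Δ` is scaled by `t`, at the frequency `ζ⁻¹`. -/
def loopWeight (X XΔ V W : Type*) (t : ℝ) (ζ : ℂ) : (X ⊕ XΔ) ⊕ (V ⊕ W) → ℂ :=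
  Sum.elim (fun _ => ζ) (Sum.elim (fun _ => 1) (fun _ => t))

variable [Fintype X] [DecidableEq X] [Fintype XΔ] [DecidableEq XΔ]
  [Fintype W] [DecidableEq W] [Fintype V] [DecidableEq V]
  (M : LTISystem X (W ⊕ Dd) (V ⊕ E)) (Δ : LTISystem XΔ V W)

/-- The return difference determinant of the loop. -/
noncomputable def loopDet (t : ℝ) (ζ : ℂ) : ℂ :=
  (1 - diagonal (loopWeight X XΔ V W t ζ) * (loopGain M Δ).map Complex.ofReal).det

theorem loopDet_eq_zero_iff (t : ℝ) (ζ : ℂ) :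
    loopDet M Δ t ζ = 0 ↔ ∃ (x : X → ℂ) (xΔ : XΔ → ℂ) (v : V → ℂ) (w : W → ℂ),
      ¬ ((x = 0 ∧ xΔ = 0) ∧ v = 0 ∧ w = 0) ∧
      (x = ζ • (M.A.map Complex.ofReal *ᵥ x + M.B.toCols₁.map Complex.ofReal *ᵥ w) ∧
        xΔ = ζ • (Δ.A.map Complex.ofReal *ᵥ xΔ + Δ.B.map Complex.ofReal *ᵥ v)) ∧
      v = M.C.toRows₁.map Complex.ofReal *ᵥ x + M.D.toBlocks₁₁.map Complex.ofReal *ᵥ w ∧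
      w = (t : ℂ) • (Δ.C.map Complex.ofReal *ᵥ xΔ + Δ.D.map Complex.ofReal *ᵥ v) := by
  have key : ∀ (x : X → ℂ) (xΔ : XΔ → ℂ) (v : V → ℂ) (w : W → ℂ),
      diagonal (loopWeight X XΔ V W t ζ) *ᵥ ((loopGain M Δ).map Complex.ofReal *ᵥ
        Sum.elim (Sum.elim x xΔ) (Sum.elim v w)) = Sum.elim (Sum.elim
          (ζ • (M.A.map Complex.ofReal *ᵥ x + M.B.toCols₁.map Complex.ofReal *ᵥ w))
          (ζ • (Δ.A.map Complex.ofReal *ᵥ xΔ + Δ.B.map Complex.ofReal *ᵥ v)))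
        (Sum.elim (M.C.toRows₁.map Complex.ofReal *ᵥ x + M.D.toBlocks₁₁.map Complex.ofReal *ᵥ w)
          ((t : ℂ) • (Δ.C.map Complex.ofReal *ᵥ xΔ + Δ.D.map Complex.ofReal *ᵥ v))) := by
    intro x xΔ v w
    ext ((i | i) | (i | i)) <;>
      simp [loopWeight, loopGain, mulVec_diagonal, fromBlocks_map, fromBlocks_mulVec, mul_add]
  rw [loopDet, ← Matrix.exists_mulVec_eq_zero_iff]
  simp only [sub_mulVec, one_mulVec, ← mulVec_mulVec, sub_eq_zero]
  constructor
  · rintro ⟨u, h0, hu⟩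
    obtain ⟨x, xΔ, v, w, rfl⟩ : ∃ x xΔ v w, u = Sum.elim (Sum.elim x xΔ) (Sum.elim v w) :=
      ⟨(u ∘ Sum.inl) ∘ Sum.inl, (u ∘ Sum.inl) ∘ Sum.inr, (u ∘ Sum.inr) ∘ Sum.inl,
        (u ∘ Sum.inr) ∘ Sum.inr, by simp only [Sum.elim_comp_inl_inr]⟩
    rw [key] at hu
    simp only [Sum.elim_eq_iff] at hu
    simp only [ne_eq, sumElim_eq_zero_iff] at h0
    exact ⟨x, xΔ, v, w, h0, hu⟩
  · rintro ⟨x, xΔ, v, w, h0, hu⟩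
    refine ⟨Sum.elim (Sum.elim x xΔ) (Sum.elim v w), ?_, ?_⟩
    · simpa only [ne_eq, sumElim_eq_zero_iff] using h0
    · rw [key]
      simpa only [Sum.elim_eq_iff] using hu

theorem continuous_loopDet : Continuous fun a : ℝ × ℂ => loopDet M Δ a.1 a.2 := by
  refine Continuous.matrix_det ?_
  refine continuous_const.sub (Continuous.matrix_mul (Continuous.matrix_diagonal ?_)
    continuous_const)
  refine continuous_pi fun i => ?_
  rcases i with (i | i | i) <;> simp only [loopWeight, Sum.elim_inl, Sum.elim_inr] <;> fun_prop

theorem differentiable_loopDet (t : ℝ) : Differentiable ℂ (loopDet M Δ t) := by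
  refine differentiable_det _ fun i j => ?_
  simp only [Matrix.sub_apply, diagonal_mul]
  rcases i with (i | i | i) <;> simp only [loopWeight, Sum.elim_inl, Sum.elim_inr] <;> fun_prop

variable {M Δ}

theorem loopDet_ne_zero_of_inv {z : ℂ} (hz : z ≠ 0) {t : ℝ}
    (h : ∀ (x : X → ℂ) (xΔ : XΔ → ℂ) (v : V → ℂ) (w : W → ℂ),
      z • x = M.A.map Complex.ofReal *ᵥ x + M.B.toCols₁.map Complex.ofReal *ᵥ w →
      z • xΔ = Δ.A.map Complex.ofReal *ᵥ xΔ + Δ.B.map Complex.ofReal *ᵥ v →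
      v = M.C.toRows₁.map Complex.ofReal *ᵥ x + M.D.toBlocks₁₁.map Complex.ofReal *ᵥ w →
      w = (t : ℂ) • (Δ.C.map Complex.ofReal *ᵥ xΔ + Δ.D.map Complex.ofReal *ᵥ v) →
      (x = 0 ∧ xΔ = 0) ∧ v = 0 ∧ w = 0) : loopDet M Δ t z⁻¹ ≠ 0 := by
  rw [ne_eq, loopDet_eq_zero_iff]
  rintro ⟨x, xΔ, v, w, h0, ⟨h1, h2⟩, h3, h4⟩
  exact h0 (h x xΔ v w (by conv_lhs => rw [h1, smul_smul, mul_inv_cancel₀ hz, one_smul])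
    (by conv_lhs => rw [h2, smul_smul, mul_inv_cancel₀ hz, one_smul]) h3 h4)

/-- At ζ = 0 the states drop out and only the direct feedthrough of the loop remains. -/
theorem wellPosed_of_loopDet_ne_zero (h : loopDet M Δ 1 0 ≠ 0) : WellPosed M Δ := by
  rw [wellPosed_iff_forall]
  intro v w hv hw
  by_contra h0
  refine h ((loopDet_eq_zero_iff ..).2 ⟨0, 0, v, w, fun h1 => h0 h1.2, by simp, ?_, ?_⟩)
  · simpa using hv
  · simpa using hw

variable [Fintype Dd]

/-- A mode with |z| ≥ 1 is a phasor with zero input, hence a null vector of the return difference at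
1/z, which lies in the closed disc. -/
theorem stable_upperLFT_of_loopDet_ne_zero (hwp : WellPosed M Δ)
    (h : ∀ ζ : ℂ, ‖ζ‖ ≤ 1 → loopDet M Δ 1 ζ ≠ 0) : (upperLFT M Δ).Stable := by
  rw [stable_iff]
  intro z hz ξ hξ
  have hz0 : z ≠ 0 := by rintro rfl; norm_num at hz
  obtain ⟨x, xΔ, rfl⟩ : ∃ x xΔ, ξ = Sum.elim x xΔ :=
    ⟨ξ ∘ Sum.inl, ξ ∘ Sum.inr, (Sum.elim_comp_inl_inr _).symm⟩
  have hp : (upperLFT M Δ).IsPhasor z (Sum.elim x xΔ) 0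
      ((upperLFT M Δ).C.map Complex.ofReal *ᵥ Sum.elim x xΔ) := by
    constructor <;> simp [hξ]
  obtain ⟨v, w, h1, h2⟩ := (hwp.isPhasor_upperLFT_iff ..).1 hp
  rw [isPhasor_sum_iff] at h1
  simp only [mulVec_zero, add_zero] at h1
  by_contra h0
  refine h z⁻¹ (by rw [norm_inv]; exact inv_le_one_of_one_le₀ hz)
    ((loopDet_eq_zero_iff ..).2 ⟨x, xΔ, v, w, fun h3 => h0 ?_, ⟨?_, ?_⟩, h1.2.1, ?_⟩)
  · rw [h3.1.1, h3.1.2, Sum.elim_zero_zero]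
  · rw [← h1.1, smul_smul, inv_mul_cancel₀ hz0, one_smul]
  · rw [← h2.1, smul_smul, inv_mul_cancel₀ hz0, one_smul]
  · rw [Complex.ofReal_one, one_smul]; exact h2.2

variable [Fintype E]

/-- Robust well-posedness and stability from frequency-dependent scalings. -/
theorem wellPosed_and_stable_of_scaling (hM : M.Stable) (hΔ : Δ.Stable)
    (hc : ∀ z : ℂ, ‖z‖ = 1 → ∀ v, l2sq (Δ.transfer z *ᵥ v) ≤ l2sq v)
    (hs : ∀ z : ℂ, ‖z‖ = 1 → ∃ s : ℝ, 0 < s ∧ ∀ w d v e, Sum.elim w d ≠ 0 →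
      M.transfer z *ᵥ (Sum.elim w d) = Sum.elim v e →
        s ^ 2 * l2sq v + l2sq e < s ^ 2 * l2sq w + l2sq d) :
    WellPosed M Δ ∧ (upperLFT M Δ).Stable := by
  -- At t = 0 the loop is cut: w vanishes, and the stability of M and then of Δ removes the
  -- remaining signals.
  have h0 : ∀ ζ : ℂ, ‖ζ‖ ≤ 1 → loopDet M Δ 0 ζ ≠ 0 := by
    intro ζ hζ h
    obtain ⟨x, xΔ, v, w, h0, ⟨h1, h2⟩, h3, h4⟩ := (loopDet_eq_zero_iff ..).1 h
    have hw : w = 0 := by simpa using h4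
    subst hw
    have hx : x = 0 := hM.eq_zero_of_eq_smul hζ (by simpa using h1)
    subst hx
    have hv : v = 0 := by simpa using h3
    subst hv
    have hxΔ : xΔ = 0 := hΔ.eq_zero_of_eq_smul hζ (by simpa using h2)
    exact h0 ⟨⟨rfl, hxΔ⟩, rfl, rfl⟩
  have h1 : ∀ t ∈ Set.Icc (0 : ℝ) 1, ∀ ζ : ℂ, ‖ζ‖ = 1 → loopDet M Δ t ζ ≠ 0 := by
    intro t ht ζ hζ
    have hζ0 : ζ ≠ 0 := by rintro rfl; simp at hζ
    have hz : ‖ζ⁻¹‖ = 1 := by rw [norm_inv, hζ, inv_one]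
    rw [← inv_inv ζ]
    refine loopDet_ne_zero_of_inv (inv_ne_zero hζ0) fun x xΔ v w hx hxΔ hv hw => ?_
    obtain ⟨s, hs0, hs⟩ := hs _ hz
    have hpM : M.IsPhasor ζ⁻¹ x (Sum.elim w 0) (Sum.elim v
        (M.C.toRows₂.map Complex.ofReal *ᵥ x + M.D.toBlocks₂₁.map Complex.ofReal *ᵥ w)) := by
      rw [isPhasor_sum_iff]
      simpa using ⟨hx, hv⟩
    have hpΔ : Δ.IsPhasor ζ⁻¹ xΔ v (Δ.C.map Complex.ofReal *ᵥ xΔ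
        + Δ.D.map Complex.ofReal *ᵥ v) := ⟨hxΔ, rfl⟩
    have hw' := hpΔ.eq_transfer hΔ hz.ge
    have hwv : l2sq w ≤ l2sq v := by
      rw [hw, hw', l2sq_smul]
      refine (mul_le_of_le_one_left (l2sq_nonneg _) ?_).trans (hc _ hz v)
      rw [Complex.norm_real, Real.norm_of_nonneg ht.1]
      exact pow_le_one₀ ht.1 ht.2
    -- With d = 0 and w ≠ 0 the weighted inequality would give s²|v|² < s²|w|², contrary to |w| ≤
    -- |v|.
    have hw0 : w = 0 := by
      by_contra hw0
      have h3 := hs w 0 v _ (by simp [sumElim_eq_zero_iff, hw0])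
        (hpM.eq_transfer hM hz.ge).symm
      rw [l2sq_zero, add_zero] at h3
      have h4 := l2sq_nonneg (M.C.toRows₂.map Complex.ofReal *ᵥ x
        + M.D.toBlocks₂₁.map Complex.ofReal *ᵥ w)
      have h5 : s ^ 2 * l2sq w ≤ s ^ 2 * l2sq v := by gcongr
      linarith
    subst hw0
    have hx0 : x = 0 := (M.stable_iff).1 hM _ hz.ge x (by simpa using hx)
    subst hx0
    have hv0 : v = 0 := by simpa using hv
    subst hv0
    exact ⟨⟨rfl, (Δ.stable_iff).1 hΔ _ hz.ge xΔ (by simpa using hxΔ)⟩, rfl, rfl⟩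
  have h2 := ne_zero_of_homotopy (loopDet M Δ) (continuous_loopDet M Δ)
    (differentiable_loopDet M Δ) h0 h1
  have hwp := wellPosed_of_loopDet_ne_zero (h2 0 (by simp))
  exact ⟨hwp, stable_upperLFT_of_loopDet_ne_zero hwp h2⟩

end Homotopy

end LTISystem

/-! ### Real all-pass functions with prescribed phase -/

/-- A first-order real all-pass function takes a prescribed unimodular value at a prescribed point
of the unit circle; a nonreal value can only be prescribed at a nonreal point. -/
theorem exists_allPass {z c : ℂ} (hz : ‖z‖ = 1) (hc : ‖c‖ = 1) (h : z.im ≠ 0 ∨ c.im = 0) :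
    ∃ a b d : ℝ, |a| < 1 ∧ (∀ ζ : ℂ, ‖ζ‖ = 1 → ‖(d : ℂ) + b / (ζ - a)‖ = 1) ∧
      (d : ℂ) + b / (z - a) = c := by
  by_cases hci : c.im = 0
  · have hcr : ((c.re : ℝ) : ℂ) = c := Complex.ext rfl (by simp [hci])
    refine ⟨0, 0, c.re, by simp, fun ζ _ => ?_, ?_⟩ <;> simp [hcr, hc]
  have hzi : z.im ≠ 0 := h.resolve_right hci
  have hc2 : c.re ^ 2 + c.im ^ 2 = 1 := by
    have := Complex.sq_norm c
    rw [hc, Complex.normSq_apply] at this; linarith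
  have hz2 : z.re ^ 2 + z.im ^ 2 = 1 := by
    have := Complex.sq_norm z
    rw [hz, Complex.normSq_apply] at this; linarith
  -- The function sought is s (1 - aζ) / (ζ - a) with s = ±1. This sign makes both (1 - Re z)(1 + s
  -- Re c) - s Im c Im z and (1 + Re z)(1 - s Re c) - s Im c Im z positive, which amounts to |a| <
  -- 1.
  obtain ⟨s, hs2, hsneg⟩ : ∃ s : ℝ, s ^ 2 = 1 ∧ s * (c.im * z.im) < 0 := by
    rcases lt_or_gt_of_ne (mul_ne_zero hci hzi) with h1 | h1
    · exact ⟨1, by norm_num, by linarith⟩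
    · exact ⟨-1, by norm_num, by linarith⟩
  have hx : -1 ≤ s * c.re ∧ s * c.re ≤ 1 := by
    rw [← abs_le, ← sq_le_one_iff_abs_le_one, mul_pow, hs2, one_mul]
    nlinarith [sq_nonneg c.im]
  have hp : -1 ≤ z.re ∧ z.re ≤ 1 := by
    rw [← abs_le, ← sq_le_one_iff_abs_le_one]
    nlinarith [sq_nonneg z.im]
  -- Solving s (1 - az) = c (z - a) gives a = (cz - s) / (c - sz). Since |z| = |c| = 1, this is the
  -- real number (Re z - s Re c) / q.
  set q : ℝ := 1 - s * (c.re * z.re + c.im * z.im) with hq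
  have hlt1 : z.re - s * c.re < q := by
    nlinarith [mul_nonneg (sub_nonneg.2 hp.2) (by linarith : 0 ≤ 1 + s * c.re)]
  have hlt2 : -(z.re - s * c.re) < q := by
    nlinarith [mul_nonneg (by linarith : 0 ≤ 1 + z.re) (by linarith : 0 ≤ 1 - s * c.re)]
  have hq0 : 0 < q := by linarith
  set a : ℝ := (z.re - s * c.re) / q with ha
  have haq : a * q = z.re - s * c.re := div_mul_cancel₀ _ hq0.ne'
  have ha1 : |a| < 1 := by
    rw [ha, abs_div, abs_of_pos hq0, div_lt_one hq0, abs_lt]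
    constructor <;> linarith
  have hne : ∀ ζ : ℂ, ‖ζ‖ = 1 → ζ - a ≠ 0 := by
    intro ζ hζ h0
    rw [sub_eq_zero.1 h0, Complex.norm_real, Real.norm_eq_abs] at hζ
    linarith
  have hform : ∀ ζ : ℂ, ‖ζ‖ = 1 →
      ((-s * a : ℝ) : ℂ) + ((s * (1 - a ^ 2) : ℝ) : ℂ) / (ζ - a) = s * (1 - a * ζ) / (ζ - a) := by
    intro ζ hζ
    have := hne ζ hζ
    field_simp
    push_cast
    ring
  refine ⟨a, s * (1 - a ^ 2), -s * a, ha1, fun ζ hζ => ?_, ?_⟩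
  · rw [hform ζ hζ, norm_div, norm_mul, div_eq_one_iff_eq (norm_ne_zero_iff.2 (hne ζ hζ))]
    have hs1 : ‖(s : ℂ)‖ = 1 := by
      rw [Complex.norm_real, Real.norm_eq_abs, ← abs_one, ← sq_eq_sq_iff_abs_eq_abs, hs2, one_pow]
    rw [hs1, one_mul, ← sq_eq_sq₀ (norm_nonneg _) (norm_nonneg _), Complex.sq_norm, Complex.sq_norm,
      Complex.normSq_apply, Complex.normSq_apply]
    have hζ2 : ζ.re ^ 2 + ζ.im ^ 2 = 1 := by
      have := Complex.sq_norm ζ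
      rw [hζ, Complex.normSq_apply] at this; linarith
    simp
    linear_combination (a ^ 2 - 1) * hζ2
  · rw [hform z hz, div_eq_iff (hne z hz)]
    have hqC : (q : ℂ) ≠ 0 := by exact_mod_cast hq0.ne'
    have hmain : (q : ℂ) * (c * z - s) = ((z.re - s * c.re : ℝ) : ℂ) * (c - s * z) := by
      apply Complex.ext
      · simp [hq]
        linear_combination s * c.im ^ 2 * hz2 + s * (1 - z.re ^ 2) * hc2 + c.im * z.im * hs2
      · simp [hq]
        linear_combination -s * z.re * z.im * hc2 - s * c.re * c.im * hz2 - c.re * z.im * hs2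
    rw [← haq] at hmain
    push_cast at hmain
    have h3 : c * z - s = a * (c - s * z) := by
      apply mul_left_cancel₀ hqC
      rw [hmain]; ring
    linear_combination -h3

/-- Diagonal real all-pass functions align the phases of a vector at a point of the circle. -/
theorem exists_allPass_mul_eq_norm {ι : Type*} {z : ℂ} (hz : ‖z‖ = 1) (v : ι → ℂ)
    (h : z.im ≠ 0 ∨ ∀ i, (v i).im = 0) :
    ∃ a b d : ι → ℝ, (∀ i, |a i| < 1) ∧
      (∀ i, ∀ ζ : ℂ, ‖ζ‖ = 1 → ‖(d i : ℂ) + b i / (ζ - a i)‖ = 1) ∧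
      ∀ i, ((d i : ℂ) + b i / (z - a i)) * v i = ‖v i‖ := by
  have key : ∀ i, ∃ a b d : ℝ, |a| < 1 ∧
      (∀ ζ : ℂ, ‖ζ‖ = 1 → ‖(d : ℂ) + b / (ζ - a)‖ = 1) ∧
      ((d : ℂ) + b / (z - a)) * v i = ‖v i‖ := by
    intro i
    obtain ⟨c, hc, hci, hcv⟩ : ∃ c : ℂ, ‖c‖ = 1 ∧ (z.im ≠ 0 ∨ c.im = 0) ∧ c * v i = ‖v i‖ := by
      rcases eq_or_ne (v i) 0 with h0 | h0
      · exact ⟨1, by simp, by simp, by simp [h0]⟩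
      · have hn : ((‖v i‖ : ℝ) : ℂ) ≠ 0 := by exact_mod_cast norm_ne_zero_iff.2 h0
        refine ⟨starRingEnd ℂ (v i) / ‖v i‖, ?_, h.imp_right fun h => ?_, ?_⟩
        · simp [h0]
        · simp [Complex.div_ofReal_im, h i]
        · rw [div_mul_eq_mul_div, Complex.conj_mul', sq, mul_div_cancel_right₀ _ hn]
    obtain ⟨a, b, d, h1, h2, h3⟩ := exists_allPass hz hc hci
    exact ⟨a, b, d, h1, h2, by rw [h3, hcv]⟩
  choose a b d h1 h2 h3 using key
  exact ⟨a, b, d, h1, h2, h3⟩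

/-- Diagonal real all-pass functions give a vector of moduli prescribed phases at a point of the
circle. -/
theorem exists_allPass_mul_norm_eq {ι : Type*} {z : ℂ} (hz : ‖z‖ = 1) (w : ι → ℂ)
    (h : z.im ≠ 0 ∨ ∀ i, (w i).im = 0) :
    ∃ a b d : ι → ℝ, (∀ i, |a i| < 1) ∧
      (∀ i, ∀ ζ : ℂ, ‖ζ‖ = 1 → ‖(d i : ℂ) + b i / (ζ - a i)‖ = 1) ∧
      ∀ i, ((d i : ℂ) + b i / (z - a i)) * ‖w i‖ = w i := by
  -- A unimodular f with f · conj w = |w| also satisfies f · |w| = w, so removing the phase of conj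
  -- w restores that of w.
  obtain ⟨a, b, d, h1, h2, h3⟩ := exists_allPass_mul_eq_norm hz (fun i => starRingEnd ℂ (w i))
    (h.imp_right fun h i => by simp [h i])
  refine ⟨a, b, d, h1, h2, fun i => ?_⟩
  have h4 := h3 i
  rw [RCLike.norm_conj] at h4
  rcases eq_or_ne (w i) 0 with h0 | h0
  · simp [h0]
  · have hn : ((‖w i‖ : ℝ) : ℂ) ≠ 0 := by exact_mod_cast norm_ne_zero_iff.2 h0
    apply mul_right_cancel₀ hn
    rw [mul_assoc, ← sq, ← Complex.conj_mul', ← mul_assoc, h4, mul_comm]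

theorem l2sq_unimodular_mul {ι : Type*} [Fintype ι] (f x : ι → ℂ) (hf : ∀ i, ‖f i‖ = 1) :
    l2sq (fun i => f i * x i) = l2sq x := by
  simp [l2sq, hf]

/-! ### Boundary interpolation by a stable real contraction -/

namespace LTISystem

open Matrix

/-- Every system is equivalent to one whose states are indexed by `Fin n`. -/
theorem exists_fin_realization {S U Y : Type*} [Fintype S] [DecidableEq S] (G : LTISystem S U Y) :
    ∃ (n : ℕ) (H : LTISystem (Fin n) U Y), (G.Stable → H.Stable) ∧ H.transfer = G.transfer := by
  let e := Fintype.equivFin S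
  refine ⟨Fintype.card S, ⟨G.A.submatrix e.symm e.symm, G.B.submatrix e.symm id,
    G.C.submatrix id e.symm, G.D⟩, fun hG => ?_, ?_⟩
  · rw [stable_iff] at hG ⊢
    intro z hz x hx
    have h1 : x ∘ e = 0 := by
      apply hG z hz
      rw [← submatrix_map, submatrix_mulVec_equiv] at hx
      ext i
      have := congrFun hx (e i)
      simpa using this
    ext i
    simpa using congrFun h1 (e.symm i)
  · ext1 z
    unfold transfer
    dsimp only
    have h1 : z • (1 : Matrix (Fin (Fintype.card S)) (Fin (Fintype.card S)) ℂ)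
        - (G.A.submatrix e.symm e.symm).map Complex.ofReal
        = (z • (1 : Matrix S S ℂ) - G.A.map Complex.ofReal).submatrix e.symm e.symm := by
      rw [submatrix_sub, ← submatrix_map]
      simp [submatrix_smul]
    rw [h1, inv_submatrix_equiv, ← submatrix_map, ← submatrix_map, submatrix_mul_equiv,
      submatrix_mul_equiv, submatrix_id_id]

section Cascade

variable {V W : Type*} [Fintype V] [DecidableEq V] [Fintype W] [DecidableEq W]

/-- The cascade of `diag (d j + b j / (z - a j))`, the gain `K` and `diag (d' i + b' i / (z - a' i))`. -/
def diagCascade (a b d : V → ℝ) (K : Matrix W V ℝ) (a' b' d' : W → ℝ) :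
    LTISystem (V ⊕ W) V W where
  A := fromBlocks (diagonal a) 0 (K * diagonal b) (diagonal a')
  B := fromRows 1 (K * diagonal d)
  C := fromCols (diagonal d' * (K * diagonal b)) (diagonal b')
  D := diagonal d' * (K * diagonal d)

variable {a b d : V → ℝ} {K : Matrix W V ℝ} {a' b' d' : W → ℝ}

theorem eq_zero_of_smul_eq_mul {ι : Type*} {a : ι → ℝ} (ha : ∀ i, |a i| < 1) {z : ℂ}
    (hz : 1 ≤ ‖z‖) {x : ι → ℂ} (hx : ∀ i, z * x i = a i * x i) : x = 0 := by
  ext i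
  have h1 := congrArg norm (hx i)
  rw [norm_mul, norm_mul, Complex.norm_real, Real.norm_eq_abs] at h1
  by_contra h0
  have h2 := mul_right_cancel₀ (norm_ne_zero_iff.2 h0) h1
  have := ha i
  linarith

theorem diagCascade_isPhasor_iff (z : ℂ) (p : V → ℂ) (r : W → ℂ) (v : V → ℂ) (w : W → ℂ) :
    (diagCascade a b d K a' b' d').IsPhasor z (Sum.elim p r) v w ↔
      ((∀ j, z * p j = a j * p j + v j) ∧
        (∀ i, z * r i = a' i * r i
          + (K.map Complex.ofReal *ᵥ fun j => (b j : ℂ) * p j + d j * v j) i)) ∧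
      ∀ i, w i = b' i * r i
        + d' i * (K.map Complex.ofReal *ᵥ fun j => (b j : ℂ) * p j + d j * v j) i := by
  have hK : ∀ f : V → ℝ, (K * diagonal f).map Complex.ofReal
      = K.map Complex.ofReal * diagonal fun j => (f j : ℂ) := by
    intro f; ext; simp
  have hK' : ∀ (g : W → ℝ) (f : V → ℝ), (diagonal g * (K * diagonal f)).map Complex.ofReal
      = (diagonal fun i => (g i : ℂ)) * (K.map Complex.ofReal * diagonal fun j => (f j : ℂ)) := by
    intro g f; ext; simp
  have hu : (fun j => (b j : ℂ) * p j + d j * v j)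
      = (diagonal fun j => (b j : ℂ)) *ᵥ p + (diagonal fun j => (d j : ℂ)) *ᵥ v := by
    ext j; simp [mulVec_diagonal]
  rw [hu, IsPhasor]
  have e1 : z • Sum.elim p r = Sum.elim (z • p) (z • r) := by
    ext (i | i) <;> rfl
  have e2 : (1 : Matrix V V ℝ).map Complex.ofReal = 1 := Matrix.map_one _ (by simp) (by simp)
  refine and_congr ?_ ?_
  · simp only [diagCascade, fromBlocks_map, fromBlocks_mulVec, fromRows_map, fromRows_mulVec, hK, e1,
      e2, ← Sum.elim_add_add, Sum.elim_eq_iff, Sum.elim_comp_inl, Sum.elim_comp_inr]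
    rw [funext_iff, funext_iff]
    refine and_congr (forall_congr' fun j => ?_) (forall_congr' fun i => ?_)
    · simp [mulVec_diagonal, Matrix.map_zero, diagonal_map]
    · simp [mulVec_diagonal, diagonal_map, mulVec_add, ← mulVec_mulVec]
      refine Eq.congr rfl ?_
      ring
  · simp only [diagCascade, fromCols_map, fromCols_mulVec_sumElim, hK', funext_iff]
    refine forall_congr' fun i => Eq.congr rfl ?_
    simp [mulVec_diagonal, diagonal_map, mulVec_add, ← mulVec_mulVec]
    ring

theorem stable_diagCascade (ha : ∀ j, |a j| < 1) (ha' : ∀ i, |a' i| < 1) :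
    (diagCascade a b d K a' b' d').Stable := by
  rw [stable_iff]
  intro z hz x hx
  obtain ⟨p, r, rfl⟩ : ∃ p r, x = Sum.elim p r :=
    ⟨x ∘ Sum.inl, x ∘ Sum.inr, (Sum.elim_comp_inl_inr _).symm⟩
  have h1 : (diagCascade a b d K a' b' d').IsPhasor z (Sum.elim p r) 0 _ :=
    ⟨by simpa using hx, rfl⟩
  obtain ⟨⟨h2, h3⟩, -⟩ := (diagCascade_isPhasor_iff ..).1 h1
  have hp : p = 0 := eq_zero_of_smul_eq_mul ha hz fun j => by simpa using h2 j
  subst hp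
  have h0 : (fun j => (b j : ℂ) * (0 : V → ℂ) j + d j * (0 : V → ℂ) j) = 0 := by ext; simp
  rw [h0, mulVec_zero] at h3
  have hr : r = 0 := eq_zero_of_smul_eq_mul ha' hz fun i => by simpa using h3 i
  rw [hr, Sum.elim_zero_zero]

theorem transfer_diagCascade_mulVec (ha : ∀ j, |a j| < 1) (ha' : ∀ i, |a' i| < 1) {z : ℂ}
    (hz : 1 ≤ ‖z‖) (v : V → ℂ) :
    (diagCascade a b d K a' b' d').transfer z *ᵥ v = fun i => ((d' i : ℂ) + b' i / (z - a' i))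
      * (K.map Complex.ofReal *ᵥ fun j => ((d j : ℂ) + b j / (z - a j)) * v j) i := by
  have hne : ∀ a : ℝ, |a| < 1 → z - a ≠ 0 := by
    intro a ha h0
    rw [sub_eq_zero.1 h0, Complex.norm_real, Real.norm_eq_abs] at hz
    linarith
  have e : (fun j => ((d j : ℂ) + b j / (z - a j)) * v j)
      = fun j => (b j : ℂ) * (v j / (z - a j)) + d j * v j := by
    ext j; ring
  set y := K.map Complex.ofReal *ᵥ fun j => ((d j : ℂ) + b j / (z - a j)) * v j with hy
  -- The states are explicit, each first-order factor dividing its input by z minus its pole.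
  have h1 : (diagCascade a b d K a' b' d').IsPhasor z
      (Sum.elim (fun j => v j / (z - a j)) (fun i => y i / (z - a' i))) v
      (fun i => ((d' i : ℂ) + b' i / (z - a' i)) * y i) := by
    rw [diagCascade_isPhasor_iff, ← e, ← hy]
    refine ⟨⟨fun j => ?_, fun i => ?_⟩, fun i => ?_⟩
    · have := hne _ (ha j)
      field_simp
      ring
    · have := hne _ (ha' i)
      field_simp
      ring
    · ring
  exact (h1.eq_transfer (stable_diagCascade ha ha') hz).symm

end Cascade

section Interpolation

variable {V W : Type*} [Fintype V]

/-- A real rank-one contraction mapping the moduli of `v` to the moduli of `w`. -/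
noncomputable def rankOneGain (w : W → ℂ) (v : V → ℂ) : Matrix W V ℝ :=
  Matrix.of fun i j => ‖w i‖ * ‖v j‖ / l2sq v

theorem rankOneGain_mulVec (w : W → ℂ) (v y : V → ℂ) : (rankOneGain w v).map Complex.ofReal *ᵥ y
    = fun i => (‖w i‖ : ℂ) * ((∑ j, (‖v j‖ : ℂ) * y j) / l2sq v) := by
  ext i
  simp only [rankOneGain, mulVec, dotProduct, Matrix.map_apply, Matrix.of_apply, Finset.sum_div,
    Finset.mul_sum]
  refine Finset.sum_congr rfl fun j _ => ?_
  push_cast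
  ring

variable [Fintype W]

theorem rankOneGain_mulVec_norm {w : W → ℂ} {v : V → ℂ} (h : l2sq w ≤ l2sq v) :
    ((rankOneGain w v).map Complex.ofReal *ᵥ fun j => (‖v j‖ : ℂ)) = fun i => (‖w i‖ : ℂ) := by
  rw [rankOneGain_mulVec]
  -- For v = 0 the gain is zero through division by zero, which is consistent because w = 0 as well.
  rcases eq_or_ne v 0 with rfl | hv
  · have hw : w = 0 := l2sq_eq_zero.1 (le_antisymm (by simpa using h) (l2sq_nonneg w))
    simp [hw]
  · have h1 : (l2sq v : ℂ) ≠ 0 := by exact_mod_cast (l2sq_pos hv).ne'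
    have h2 : ∑ j, (‖v j‖ : ℂ) * ‖v j‖ = l2sq v := by
      rw [l2sq]; push_cast
      exact Finset.sum_congr rfl fun j _ => (sq _).symm
    simp [h2, h1]

/-- Cauchy–Schwarz against the moduli of v gives a factor |v|²|y|², and |w| ≤ |v| absorbs the rest.
-/
theorem l2sq_rankOneGain_mulVec_le {w : W → ℂ} {v : V → ℂ} (h : l2sq w ≤ l2sq v) (y : V → ℂ) :
    l2sq ((rankOneGain w v).map Complex.ofReal *ᵥ y) ≤ l2sq y := by
  rw [rankOneGain_mulVec]
  have e : (fun i => (‖w i‖ : ℂ) * ((∑ j, (‖v j‖ : ℂ) * y j) / l2sq v))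
      = ((∑ j, (‖v j‖ : ℂ) * y j) / l2sq v) • fun i => (‖w i‖ : ℂ) := by
    ext i; simp [mul_comm]
  have hw : l2sq (fun i => (‖w i‖ : ℂ)) = l2sq w := by simp [l2sq]
  rw [e, l2sq_smul, hw, norm_div, Complex.norm_real, Real.norm_of_nonneg (l2sq_nonneg v), div_pow]
  rcases (l2sq_nonneg v).eq_or_lt with h0 | h0
  · rw [← h0]; simpa using l2sq_nonneg y
  · have hcs : ‖∑ j, (‖v j‖ : ℂ) * y j‖ ^ 2 ≤ l2sq v * l2sq y := by
      have h1 : ‖∑ j, (‖v j‖ : ℂ) * y j‖ ≤ ∑ j, ‖v j‖ * ‖y j‖ :=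
        (norm_sum_le _ _).trans (by simp)
      calc _ ≤ (∑ j, ‖v j‖ * ‖y j‖) ^ 2 := by gcongr
        _ ≤ _ := Finset.sum_mul_sq_le_sq_mul_sq _ _ _
    rw [div_mul_eq_mul_div, div_le_iff₀ (by positivity)]
    calc _ ≤ l2sq v * l2sq y * l2sq v := mul_le_mul hcs h (l2sq_nonneg w)
          (mul_nonneg h0.le (l2sq_nonneg y))
      _ = _ := by ring

/-- Boundary interpolation: a stable real system of norm at most one with `Δ(z) v = w` exists at a
point `z` of the circle as soon as `w` is no longer than `v`, provided that `z` is nonreal or `v`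
and `w` are real. -/
theorem exists_interpolant [DecidableEq V] [DecidableEq W] {z : ℂ} (hz : ‖z‖ = 1) {v : V → ℂ}
    {w : W → ℂ} (h : l2sq w ≤ l2sq v)
    (hreal : z.im ≠ 0 ∨ (∀ j, (v j).im = 0) ∧ ∀ i, (w i).im = 0) :
    ∃ (n : ℕ) (Δ : LTISystem (Fin n) V W), Δ.Stable ∧ Δ.hinfNorm ≤ 1 ∧ Δ.transfer z *ᵥ v = w := by
  -- Three real factors: all-passes that strip the phases of v, a constant gain that sends moduli to
  -- moduli, all-passes that insert the phases of w. The outer factors preserve norms on the circle,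
  -- so the cascade is a contraction.
  obtain ⟨a, b, d, ha, hu, hv⟩ := exists_allPass_mul_eq_norm hz v (hreal.imp_right And.left)
  obtain ⟨a', b', d', ha', hu', hw⟩ := exists_allPass_mul_norm_eq hz w (hreal.imp_right And.right)
  obtain ⟨n, Δ, hst, htr⟩ :=
    (diagCascade a b d (rankOneGain w v) a' b' d').exists_fin_realization
  have hΔ := hst (stable_diagCascade ha ha')
  refine ⟨n, Δ, hΔ, ?_, ?_⟩
  · rw [hinfNorm_le_one_iff hΔ]
    intro ζ hζ
    rw [sigmaMax_le_one_iff, htr]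
    intro x
    rw [transfer_diagCascade_mulVec ha ha' hζ.ge, l2sq_unimodular_mul _ _ fun i => hu' i ζ hζ]
    refine (l2sq_rankOneGain_mulVec_le h _).trans ?_
    rw [l2sq_unimodular_mul _ _ fun i => hu i ζ hζ]
  · rw [htr, transfer_diagCascade_mulVec ha ha' hz.ge]
    simp only [hv]
    rw [rankOneGain_mulVec_norm h]
    exact funext hw

end Interpolation

end LTISystem

/-! ### From the S-lemma to a scaling -/

section SqForm

variable {ι E : Type*} [Fintype ι] [NormedAddCommGroup E] [NormedSpace ℝ E]

/-- The real quadratic form `x ↦ l2sq (L x)`. -/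
noncomputable def l2sqForm (L : E →ₗ[ℝ] ι → ℂ) : QuadraticForm ℝ E :=
  ∑ i, (QuadraticMap.sq.comp (Complex.reLm ∘ₗ LinearMap.proj i ∘ₗ L)
    + QuadraticMap.sq.comp (Complex.imLm ∘ₗ LinearMap.proj i ∘ₗ L))

theorem l2sqForm_apply (L : E →ₗ[ℝ] ι → ℂ) (x : E) : l2sqForm L x = l2sq (L x) := by
  rw [l2sqForm, _root_.sum_apply, l2sq]
  refine Finset.sum_congr rfl fun i _ => ?_
  rw [Complex.sq_norm, Complex.normSq_apply]
  simp

theorem continuous_l2sqForm [FiniteDimensional ℝ E] (L : E →ₗ[ℝ] ι → ℂ) :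
    Continuous (l2sqForm L) := by
  have hL : Continuous L := L.continuous_of_finiteDimensional
  simp only [funext (l2sqForm_apply L), l2sq]
  fun_prop

end SqForm

/-- The S-lemma for the performance and uncertainty channels of a matrix, on a real space of
admissible input directions. -/
theorem exists_scaling_of_forall {W Dd V E F : Type*} [Fintype W] [Fintype Dd] [Fintype V]
    [Fintype E] [NormedAddCommGroup F] [NormedSpace ℝ F] [FiniteDimensional ℝ F]
    (N : Matrix (V ⊕ E) (W ⊕ Dd) ℂ) (J : F →ₗ[ℝ] (W ⊕ Dd → ℂ)) (hJ : Function.Injective J)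
    (h : ∀ x w d v e, J x = Sum.elim w d → Sum.elim w d ≠ 0 →
      N.mulVec (Sum.elim w d) = Sum.elim v e → l2sq w ≤ l2sq v → l2sq e < l2sq d) :
    ∃ s : ℝ, 0 < s ∧ ∀ x w d v e, J x = Sum.elim w d → Sum.elim w d ≠ 0 →
      N.mulVec (Sum.elim w d) = Sum.elim v e →
        s ^ 2 * l2sq v + l2sq e < s ^ 2 * l2sq w + l2sq d := by
  let NJ : F →ₗ[ℝ] (V ⊕ E → ℂ) := N.mulVecLin.restrictScalars ℝ ∘ₗ J
  let q₁ : QuadraticForm ℝ F := l2sqForm (LinearMap.funLeft ℝ ℂ Sum.inl ∘ₗ NJ)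
    - l2sqForm (LinearMap.funLeft ℝ ℂ Sum.inl ∘ₗ J)
  let q₂ : QuadraticForm ℝ F := l2sqForm (LinearMap.funLeft ℝ ℂ Sum.inr ∘ₗ NJ)
    - l2sqForm (LinearMap.funLeft ℝ ℂ Sum.inr ∘ₗ J)
  have hq : ∀ x w d v e, J x = Sum.elim w d → N.mulVec (Sum.elim w d) = Sum.elim v e →
      q₁ x = l2sq v - l2sq w ∧ q₂ x = l2sq e - l2sq d := by
    intro x w d v e hx hN
    have hNJ : NJ x = Sum.elim v e := by
      rw [← hN, ← hx]; rfl
    constructor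
    · rw [_root_.sub_apply, l2sqForm_apply, l2sqForm_apply, LinearMap.comp_apply _ NJ, hNJ,
        LinearMap.comp_apply, hx]
      rfl
    · rw [_root_.sub_apply, l2sqForm_apply, l2sqForm_apply, LinearMap.comp_apply _ NJ, hNJ,
        LinearMap.comp_apply, hx]
      rfl
  have := FiniteDimensional.proper_real F
  obtain ⟨t, ht, hneg⟩ := exists_pos_forall_neg q₁ q₂
    ((continuous_l2sqForm _).sub (continuous_l2sqForm _))
    ((continuous_l2sqForm _).sub (continuous_l2sqForm _)) (by
      intro x hx h1
      have hw : J x = Sum.elim (J x ∘ Sum.inl) (J x ∘ Sum.inr) := (Sum.elim_comp_inl_inr _).symm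
      have hv := (Sum.elim_comp_inl_inr (N.mulVec (Sum.elim (J x ∘ Sum.inl) (J x ∘ Sum.inr)))).symm
      obtain ⟨e1, e2⟩ := hq x _ _ _ _ hw hv
      rw [e1, sub_nonneg] at h1
      rw [e2, sub_neg]
      refine h x _ _ _ _ hw ?_ hv h1
      rw [← hw]
      exact fun h0 => hx (hJ (by rw [h0, map_zero])))
  -- The scaling enters the inequality through its square.
  refine ⟨√t, Real.sqrt_pos.2 ht, fun x w d v e hx h0 hN => ?_⟩
  have h1 := hneg x (by rintro rfl; exact h0 (by rw [← hx, map_zero]))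
  obtain ⟨e1, e2⟩ := hq x w d v e hx hN
  rw [e1, e2] at h1
  rw [Real.sq_sqrt ht.le]
  linarith

/-! ### Robust performance and scalings at each frequency -/

namespace LTISystem

open Matrix

theorem ofReal_comp_sumElim {α β : Type*} (f : ℂ → ℝ) (p : α → ℂ) (q : β → ℂ) :
    (fun i => (f (Sum.elim p q i) : ℂ))
      = Sum.elim (fun i => (f (p i) : ℂ)) (fun i => (f (q i) : ℂ)) := by
  ext (i | i) <;> rfl

theorem conj_map_ofReal_mulVec {α β : Type*} [Fintype β] (A : Matrix α β ℝ) (x : β → ℂ) (i : α) :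
    starRingEnd ℂ ((A.map Complex.ofReal *ᵥ x) i)
      = (A.map Complex.ofReal *ᵥ fun i => starRingEnd ℂ (x i)) i := by
  simp [mulVec, dotProduct]

/-- A matrix which maps real vectors to real vectors commutes with real and imaginary parts. -/
theorem mulVec_re_im {α β : Type*} [Fintype β] {N : Matrix α β ℂ}
    (hN : ∀ u : β → ℂ, (∀ i, (u i).im = 0) → ∀ i, ((N *ᵥ u) i).im = 0) (u : β → ℂ) :
    ((N *ᵥ fun i => ((u i).re : ℂ)) = fun i => (((N *ᵥ u) i).re : ℂ)) ∧
      (N *ᵥ fun i => ((u i).im : ℂ)) = fun i => (((N *ᵥ u) i).im : ℂ) := by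
  have hr := hN (fun i => ((u i).re : ℂ)) fun i => Complex.ofReal_im _
  have hi := hN (fun i => ((u i).im : ℂ)) fun i => Complex.ofReal_im _
  have hu : u = (fun i => ((u i).re : ℂ)) + Complex.I • fun i => ((u i).im : ℂ) := by
    ext i
    simp only [Pi.add_apply, Pi.smul_apply, smul_eq_mul]
    rw [mul_comm, Complex.re_add_im]
  have h1 : ∀ i, (N *ᵥ u) i = (N *ᵥ fun i => ((u i).re : ℂ)) i
      + Complex.I * (N *ᵥ fun i => ((u i).im : ℂ)) i := by
    intro i
    conv_lhs => rw [hu, mulVec_add, mulVec_smul]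
    rfl
  constructor
  · ext1 i
    apply Complex.ext
    · simp [h1, hi]
    · simp [hr]
  · ext1 i
    apply Complex.ext
    · simp [h1, hr]
    · simp [hi]

/-- The transfer matrix maps real vectors to real vectors at real points. -/
theorem transfer_mulVec_im_eq_zero {X U Y : Type*} [Fintype X] [DecidableEq X] [Fintype U]
    {G : LTISystem X U Y} (hG : G.Stable) {z : ℂ} (hz : 1 ≤ ‖z‖) (hzi : z.im = 0) {u : U → ℂ}
    (hu : ∀ i, (u i).im = 0) (i : Y) : ((G.transfer z *ᵥ u) i).im = 0 := by
  obtain ⟨x, hx⟩ := exists_isPhasor hG hz u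
  -- Conjugating a phasor at a real point with real input gives a phasor with the same input. The
  -- output is determined by the input, so it equals its conjugate.
  have hx' : G.IsPhasor z (fun i => starRingEnd ℂ (x i)) u
      (fun i => starRingEnd ℂ ((G.transfer z *ᵥ u) i)) := by
    have hu' : (fun i => starRingEnd ℂ (u i)) = u := funext fun i => Complex.conj_eq_iff_im.2 (hu i)
    constructor
    · ext i
      have := congrArg (starRingEnd ℂ) (congrFun hx.1 i)
      simp only [Pi.smul_apply, Pi.add_apply, smul_eq_mul, map_mul, map_add,
        conj_map_ofReal_mulVec, hu', Complex.conj_eq_iff_im.2 hzi] at this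
      exact this
    · ext i
      have := congrArg (starRingEnd ℂ) (congrFun hx.2 i)
      simp only [Pi.add_apply, map_add, conj_map_ofReal_mulVec G.C, conj_map_ofReal_mulVec G.D, hu']
        at this
      exact this
  exact Complex.conj_eq_iff_im.1 (congrFun (hx'.eq_transfer hG hz) i)

section Robust

variable {X XΔ W Dd V E : Type*} [Fintype X] [DecidableEq X] [Fintype XΔ] [DecidableEq XΔ]
  [Fintype W] [DecidableEq W] [Fintype V] [DecidableEq V] [Fintype Dd] [Fintype E]
  {M : LTISystem X (W ⊕ Dd) (V ⊕ E)} {Δ : LTISystem XΔ V W}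

/-- Robust performance from frequency-dependent scalings. -/
theorem robust_performance_of_scaling [DecidableEq Dd] (hM : M.Stable) (hΔ : Δ.Stable)
    (hn : Δ.hinfNorm ≤ 1)
    (hs : ∀ z : ℂ, ‖z‖ = 1 → ∃ s : ℝ, 0 < s ∧ ∀ w d v e, Sum.elim w d ≠ 0 →
      M.transfer z *ᵥ (Sum.elim w d) = Sum.elim v e →
        s ^ 2 * l2sq v + l2sq e < s ^ 2 * l2sq w + l2sq d) :
    WellPosed M Δ ∧ (upperLFT M Δ).Stable ∧ (upperLFT M Δ).hinfNorm < 1 := by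
  have hc : ∀ z : ℂ, ‖z‖ = 1 → ∀ v, l2sq (Δ.transfer z *ᵥ v) ≤ l2sq v := fun z hz =>
    (sigmaMax_le_one_iff _).1 ((hinfNorm_le_one_iff hΔ).1 hn z hz)
  obtain ⟨hwp, hst⟩ := wellPosed_and_stable_of_scaling hM hΔ hc hs
  refine ⟨hwp, hst, (hinfNorm_lt_one_iff hst).2 fun z hz => (sigmaMax_lt_one_iff _).2 ?_⟩
  intro d hd
  obtain ⟨ξ, hξ⟩ := exists_isPhasor hst hz.ge d
  rw [← Sum.elim_comp_inl_inr ξ, hwp.isPhasor_upperLFT_iff] at hξ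
  obtain ⟨v, w, hpM, hpΔ⟩ := hξ
  obtain ⟨s, hs0, hs⟩ := hs z hz
  have h1 := hs w d v _ (fun h => hd ((sumElim_eq_zero_iff _ _).1 h).2)
    (hpM.eq_transfer hM hz.ge).symm
  have h2 : l2sq w ≤ l2sq v := by
    rw [hpΔ.eq_transfer hΔ hz.ge]
    exact hc z hz v
  have h3 : s ^ 2 * l2sq w ≤ s ^ 2 * l2sq v := by gcongr
  linarith

/-- Robust performance excludes signals which `M` expands in both channels at a frequency. -/
theorem l2sq_lt_of_robust_performance [DecidableEq Dd] (hM : M.Stable)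
    (hB : ∀ (n : ℕ) (Δ : LTISystem (Fin n) V W), Δ.Stable → Δ.hinfNorm ≤ 1 →
      WellPosed M Δ ∧ (upperLFT M Δ).Stable ∧ (upperLFT M Δ).hinfNorm < 1)
    {z : ℂ} (hz : ‖z‖ = 1) {w : W → ℂ} {d : Dd → ℂ} {v : V → ℂ} {e : E → ℂ}
    (h0 : Sum.elim w d ≠ 0) (hN : M.transfer z *ᵥ (Sum.elim w d) = Sum.elim v e)
    (hwv : l2sq w ≤ l2sq v)
    (hreal : z.im ≠ 0 ∨ (∀ j, (v j).im = 0) ∧ ∀ i, (w i).im = 0) : l2sq e < l2sq d := by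
  obtain ⟨n, Δ, hΔ, hn, hvw⟩ := exists_interpolant hz hwv hreal
  obtain ⟨hwp, hst, hlt⟩ := hB n Δ hΔ hn
  obtain ⟨x, hx⟩ := exists_isPhasor hM hz.ge (Sum.elim w d)
  obtain ⟨xΔ, hxΔ⟩ := exists_isPhasor hΔ hz.ge v
  rw [hN] at hx
  rw [hvw] at hxΔ
  have hp := (hwp.isPhasor_upperLFT_iff z x xΔ d e).2 ⟨v, w, hx, hxΔ⟩
  -- With d = 0 the phasor is a mode on the circle: stability annihilates the states, and
  -- well-posedness then annihilates w.
  have hd : d ≠ 0 := by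
    rintro rfl
    have hξ : Sum.elim x xΔ = 0 := by
      refine (stable_iff _).1 hst z hz.ge _ ?_
      rw [hp.1, mulVec_zero, add_zero]
    obtain ⟨rfl, rfl⟩ := (sumElim_eq_zero_iff _ _).1 hξ
    rw [isPhasor_sum_iff] at hx
    obtain ⟨-, rfl⟩ := (wellPosed_iff_forall M Δ).1 hwp v w (by simpa using hx.2.1)
      (by simpa using hxΔ.2)
    exact h0 Sum.elim_zero_zero
  rw [hp.eq_transfer hst hz.ge]
  exact (sigmaMax_lt_one_iff _).1 ((hinfNorm_lt_one_iff hst).1 hlt z hz) d hd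

/-- Robust performance yields a scaling at every frequency. -/
theorem exists_scaling_of_robust_performance [DecidableEq Dd] (hM : M.Stable)
    (hB : ∀ (n : ℕ) (Δ : LTISystem (Fin n) V W), Δ.Stable → Δ.hinfNorm ≤ 1 →
      WellPosed M Δ ∧ (upperLFT M Δ).Stable ∧ (upperLFT M Δ).hinfNorm < 1)
    {z : ℂ} (hz : ‖z‖ = 1) : ∃ s : ℝ, 0 < s ∧ ∀ w d v e, Sum.elim w d ≠ 0 →
      M.transfer z *ᵥ (Sum.elim w d) = Sum.elim v e →
        s ^ 2 * l2sq v + l2sq e < s ^ 2 * l2sq w + l2sq d := by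
  by_cases hzi : z.im = 0
  -- At z = ±1 only real directions are excluded by real Δ, so the S-lemma runs over real vectors.
  · let J : (W ⊕ Dd → ℝ) →ₗ[ℝ] (W ⊕ Dd → ℂ) := Complex.ofRealCLM.toLinearMap.compLeft (W ⊕ Dd)
    have hJ : ∀ x i, J x i = (x i : ℂ) := fun x i => rfl
    have him : ∀ {u : W ⊕ Dd → ℂ}, (∀ i, (u i).im = 0) → ∀ i, ((M.transfer z *ᵥ u) i).im = 0 :=
      fun hu => transfer_mulVec_im_eq_zero hM hz.ge hzi hu
    obtain ⟨s, hs0, hs⟩ := exists_scaling_of_forall (M.transfer z) J (by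
        intro x y hxy
        ext i
        have := congrFun hxy i
        rwa [hJ, hJ, Complex.ofReal_inj] at this) (by
      intro x w d v e hx h0 hN hwv
      have hreal : ∀ i, (Sum.elim w d i).im = 0 := by
        intro i
        rw [← hx, hJ, Complex.ofReal_im]
      have hreal' := him hreal
      rw [hN] at hreal'
      exact l2sq_lt_of_robust_performance hM hB hz h0 hN hwv
        (Or.inr ⟨fun j => hreal' (Sum.inl j), fun i => hreal (Sum.inl i)⟩))
    refine ⟨s, hs0, fun w d v e h0 hN => ?_⟩
    obtain ⟨hre, him⟩ := mulVec_re_im (fun u hu => him hu) (Sum.elim w d)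
    rw [hN] at hre him
    -- Only one of the real and imaginary parts need be nonzero: that part gives the strict
    -- inequality, the other this weak one.
    have hle : ∀ (x : W ⊕ Dd → ℝ) w d v e, J x = Sum.elim w d →
        M.transfer z *ᵥ (Sum.elim w d) = Sum.elim v e →
        s ^ 2 * l2sq v + l2sq e ≤ s ^ 2 * l2sq w + l2sq d := by
      intro x w d v e hx hN
      rcases eq_or_ne (Sum.elim w d) 0 with h0 | h0
      · rw [h0, mulVec_zero, eq_comm, sumElim_eq_zero_iff] at hN
        simp [hN, (sumElim_eq_zero_iff _ _).1 h0]
      · exact (hs x w d v e hx h0 hN).le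
    rw [ofReal_comp_sumElim Complex.re, ofReal_comp_sumElim Complex.re] at hre
    rw [ofReal_comp_sumElim Complex.im, ofReal_comp_sumElim Complex.im] at him
    have hJre := ofReal_comp_sumElim Complex.re w d
    have hJim := ofReal_comp_sumElim Complex.im w d
    rw [l2sq_re_add_im v, l2sq_re_add_im e, l2sq_re_add_im w, l2sq_re_add_im d]
    have h1 := hle (fun i => (Sum.elim w d i).re) _ _ _ _ hJre hre
    have h2 := hle (fun i => (Sum.elim w d i).im) _ _ _ _ hJim him
    by_cases h3 : (fun i => ((Sum.elim w d i).re : ℂ)) = 0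
    · have h4 : (fun i => ((Sum.elim w d i).im : ℂ)) ≠ 0 := fun h4 => h0 (by
        ext1 i
        have h5 := congrFun h3 i
        have h6 := congrFun h4 i
        exact Complex.ext (by simpa using h5) (by simpa using h6))
      have h5 := hs (fun i => (Sum.elim w d i).im) _ _ _ _ hJim (hJim ▸ h4) him
      linarith
    · have h5 := hs (fun i => (Sum.elim w d i).re) _ _ _ _ hJre (hJre ▸ h3) hre
      linarith
  -- At a nonreal z interpolation has no reality constraint, so the S-lemma runs over all complex
  -- vectors, regarded as a real space.
  · obtain ⟨s, hs0, hs⟩ := exists_scaling_of_forall (M.transfer z)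
      (LinearMap.id : (W ⊕ Dd → ℂ) →ₗ[ℝ] _) Function.injective_id
      (fun _ w d v e _ h0 hN hwv =>
        l2sq_lt_of_robust_performance hM hB hz h0 hN hwv (Or.inl hzi))
    exact ⟨s, hs0, fun w d v e h0 hN => hs _ w d v e rfl h0 hN⟩

end Robust

end LTISystem

theorem mainTheorem6 (nx nw nd nv ne : ℕ)
    (M : LTISystem (Fin nx) (Fin nw ⊕ Fin nd) (Fin nv ⊕ Fin ne)) (hM : M.Stable) :
    (∃ D : ℝ → ℝ, (∀ θ ∈ Set.Icc 0 (2 * Real.pi), 0 < D θ) ∧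
        ∀ θ ∈ Set.Icc 0 (2 * Real.pi),
          sigmaMax (scaledMatrix (D θ) (M.freqResp θ)) < 1) ↔
      (∀ (nΔ : ℕ) (Δ : LTISystem (Fin nΔ) (Fin nv) (Fin nw)),
        Δ.Stable → Δ.hinfNorm ≤ 1 →
          LTISystem.WellPosed M Δ ∧ (LTISystem.upperLFT M Δ).Stable ∧
            (LTISystem.upperLFT M Δ).hinfNorm < 1) := by
  constructor
  · rintro ⟨D, hD, h⟩ n Δ hΔ hn
    refine LTISystem.robust_performance_of_scaling hM hΔ hn fun z hz => ?_
    obtain ⟨θ, hθ, rfl⟩ := LTISystem.exists_exp_eq hz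
    exact ⟨D θ, hD θ hθ, (sigmaMax_scaledMatrix_lt_one_iff (hD θ hθ) _).1 (h θ hθ)⟩
  · intro hB
    -- The scalings are chosen independently at each θ.
    choose s hs0 hs using fun θ : ℝ => LTISystem.exists_scaling_of_robust_performance hM hB
      (Complex.norm_exp_ofReal_mul_I θ)
    exact ⟨s, fun θ _ => hs0 θ, fun θ _ =>
      (sigmaMax_scaledMatrix_lt_one_iff (hs0 θ) _).2 (hs θ)⟩
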